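/- Let $n\ge 1$. The Klein model identifies $\mathbb H^n$ with the open Euclidean unit ball $\{x\in\mathbb R^n: |x|<1\}$, with Riemannian metric $$g_x(u,v)=\frac{\langle u,v\rangle}{1-|x|^2}+\frac{\langle x,u\rangle\langle x,v\rangle}{(1-|x|^2)^2}$$ and volume measure $d\mathrm{vol}_g=(1-|x|^2)^{-\frac{n+1}{2}}\,dx$. For $c\in\mathbb H^n$ and $v\in T_c\mathbb H^n$ let $H_c(v)=\{\exp_c(w): w\in T_c\mathbb H^n,\ g_c(w,v)<0\}$. A point $c\in\mathbb H^n$ is a $\beta$-centerpoint of a probability measure $\mu$ on $\mathbb H^n$ if $\mu(H_c(v))\le 1-\beta$ for all $v\in T_c\mathbb H^n$. It is an optimal centerpoint of $\mu$ if it minimizes $G(y)=\sup_{v}\mu(H_y(v))$ over $y\in\mathbb H^n$. A set $S\subseteq\mathbb H^n$ is convex if any two points of $S$ are joined by a unique length-minimizing geodesic and this geodesic is contained in $S$. Let $\delta>0$ be small enough that $(n-1)(1+\delta)^2\le n+1$. Let $T(1+\delta)\subset\mathbb R^n$ be a closed regular $n$-simplex whose $n+1$ vertices lie on the Euclidean sphere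 of radius $1+\delta$ about the origin. For $0<\epsilon<1$ let $S_\epsilon=T(1+\delta)\cap\{x:|x|\le 1-\epsilon\}$. Then for every $\epsilon\in(0,1)$ the set $S_\epsilon\subset\mathbb H^n$ is convex and compact, and $\mu_\epsilon=\frac{\mathbb 1_{S_\epsilon}}{\mathrm{vol}_g(S_\epsilon)}\mathrm{vol}_g$ is a probability measure. It has exactly one optimal centerpoint $c_\epsilon$, and there is a largest number $\beta_\epsilon$ such that $c_\epsilon$ is a $\beta_\epsilon$-centerpoint of $\mu_\epsilon$. Moreover $$\lim_{\epsilon\to0^+}\beta_\epsilon=\frac1{n+1}.$$ -/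

import Mathlib

open MeasureTheory Set Filter Topology

noncomputable section

namespace Klein

/-- Euclidean space `ℝⁿ`. -/
abbrev E (n : ℕ) : Type := EuclideanSpace ℝ (Fin n)

/-- The underlying set of the Klein model of hyperbolic space `ℍⁿ`: the open unit ball. -/
def space (n : ℕ) : Set (E n) := Metric.ball 0 1

/-- The Klein metric
`g_x(u,v) = ⟨u,v⟩ / (1 - |x|²) + ⟨x,u⟩⟨x,v⟩ / (1 - |x|²)²`, for `x` in the open unit ball. -/
def metric {n : ℕ} (x u v : E n) : ℝ :=
  inner ℝ u v / (1 - ‖x‖ ^ 2) + inner ℝ x u * inner ℝ x v / (1 - ‖x‖ ^ 2) ^ 2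

/-- The Riemannian volume measure of the Klein model, with density
`(1 - |x|²)^(-(n+1)/2)` with respect to Lebesgue measure on the open unit ball. -/
def vol (n : ℕ) : Measure (E n) :=
  (volume.restrict (space n)).withDensity
    (fun x => ENNReal.ofReal (1 / (1 - ‖x‖ ^ 2) ^ (((n : ℝ) + 1) / 2)))

/-- Christoffel symbols of the first kind of the Klein metric, i.e. `g_x(Γ_x(a,b), u)`:
`½ (D_a g(b,u) + D_b g(a,u) - D_u g(a,b))`, the derivatives being taken at `x`. -/
def christoffel {n : ℕ} (x a b u : E n) : ℝ :=
  (1 / 2) * (fderiv ℝ (fun y => metric y b u) x a + fderiv ℝ (fun y => metric y a u) x b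
    - fderiv ℝ (fun y => metric y a b) x u)

/-- `γ : ℝ → ℍⁿ` is a geodesic: `∇_{γ'} γ' = 0` for the Levi-Civita connection of the Klein
metric (written with the free index lowered, that is, paired with every vector `u`). -/
structure IsGeodesic {n : ℕ} (γ : ℝ → E n) : Prop where
  contDiff : ContDiff ℝ 2 γ
  mem_space : ∀ t, γ t ∈ space n
  equation : ∀ t u,
    metric (γ t) (deriv (deriv γ) t) u + christoffel (γ t) (deriv γ t) (deriv γ t) u = 0

/-- `IsExp x w y` says that `y = exp_x(w)`. -/
def IsExp {n : ℕ} (x w y : E n) : Prop :=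
  ∃ γ : ℝ → E n, IsGeodesic γ ∧ γ 0 = x ∧ deriv γ 0 = w ∧ γ 1 = y

/-- The open halfspace `H_x(v) = { exp_x(w) | w ∈ T_x ℍⁿ, g_x(w,v) < 0 }`. -/
def halfspace {n : ℕ} (x v : E n) : Set (E n) :=
  {y | ∃ w, metric x w v < 0 ∧ IsExp x w y}

/-- The Riemannian length of the curve `η` restricted to `[0,1]`. -/
def length {n : ℕ} (η : ℝ → E n) : ℝ :=
  ∫ t in (0 : ℝ)..1, Real.sqrt (metric (η t) (deriv η t) (deriv η t))

/-- `γ` restricted to `[0,1]` is a length-minimizing geodesic from `x` to `y`. -/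
structure IsMinGeodesic {n : ℕ} (x y : E n) (γ : ℝ → E n) : Prop where
  isGeodesic : IsGeodesic γ
  start : γ 0 = x
  finish : γ 1 = y
  minimizing : ∀ η : ℝ → E n, ContDiff ℝ 1 η → (∀ t ∈ Icc (0 : ℝ) 1, η t ∈ space n) →
    η 0 = x → η 1 = y → length γ ≤ length η

/-- `S ⊆ ℍⁿ` is (geodesically) convex: any two points of `S` are joined by a unique
length-minimizing geodesic, and this geodesic is contained in `S`. -/
def GeodesicallyConvex {n : ℕ} (S : Set (E n)) : Prop :=
  S ⊆ space n ∧ ∀ x ∈ S, ∀ y ∈ S, ∃ γ, IsMinGeodesic x y γ ∧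
    (∀ γ', IsMinGeodesic x y γ' → γ' = γ) ∧ ∀ t ∈ Icc (0 : ℝ) 1, γ t ∈ S

/-- `c ∈ ℍⁿ` is a `β`-centerpoint of the probability measure `μ`. -/
def IsCenterpoint {n : ℕ} (μ : Measure (E n)) (β : ℝ) (c : E n) : Prop :=
  c ∈ space n ∧ ∀ v : E n, μ.real (halfspace c v) ≤ 1 - β

/-- The centrality function `G(y) = sup_v μ(H_y(v))`. -/
def centrality {n : ℕ} (μ : Measure (E n)) (y : E n) : ENNReal :=
  ⨆ v : E n, μ (halfspace y v)

/-- `c` is an optimal centerpoint of `μ`: it minimizes the centrality function over `ℍⁿ`. -/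
def IsOptimalCenterpoint {n : ℕ} (μ : Measure (E n)) (c : E n) : Prop :=
  c ∈ space n ∧ ∀ y ∈ space n, centrality μ c ≤ centrality μ y

/-- `S_ε = T ∩ B(1 - ε)`: the closed simplex `T` with the vertices of `s`, intersected with the
closed Euclidean ball of radius `1 - ε` about the origin. -/
def truncated {n : ℕ} (s : Affine.Simplex ℝ (E n) n) (ε : ℝ) : Set (E n) :=
  convexHull ℝ (range s.points) ∩ Metric.closedBall 0 (1 - ε)

/-- The uniform probability measure `(1_S / vol(S)) · vol` on `S`. -/
def uniform {n : ℕ} (S : Set (E n)) : Measure (E n) :=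
  ProbabilityTheory.cond (vol n) S

end Klein

end

namespace Klein

/-! ### Geodesics of the Klein model -/

section Geodesics

variable {n : ℕ}

/-! In the Klein model geodesics are straight chords: the geodesic equation says that `γ' / (1 -
|γ|²)` is constant. A geodesic minimizes length because the Busemann function of its ideal endpoint,
which is 1-Lipschitz, changes along it at unit rate in arc length. Hence Euclidean convex subsets of
the ball are geodesically convex, and the halfspaces at `c` are exactly the Euclidean halfspaces
bounded by hyperplanes through `c` (`halfspace_eq`).

The symmetries of the simplex are linear isometries preserving `μ_ε`, and the `n + 1` cyclic
rotations of the vertices send any point to points with sum zero. So for each direction `u` some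
image `A y` satisfies `⟨A y, u⟩ ≥ 0`, and the halfspace at `0` is contained in the one at `A y`: the
origin is optimal. If `y ≠ 0`, some image satisfies `⟨A y, u⟩ ≥ η > 0` with `η` independent of `u`,
and the slab gained contains a ball of fixed size; hence uniqueness
(`IsRegular.centrality_zero_lt`).

For the value of `β_ε`: the complements of a halfspace at `0`, rotated, cover the space, so `β_ε ≥ 1
/ (n + 1)`. Conversely `β_ε` is at most the mass of each of the `n + 1` halfspaces facing a vertex.
The bound on `δ` makes two of these meet the simplex only inside the open unit ball
(`IsRegular.norm_lt_one`). Hyperbolic volume is infinite and concentrates near the sphere, where the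
simplex fills a cone of positive measure, so the overlaps have vanishing mass. By Bonferroni, `(n +
1) β_ε ≤ 1 + o(1)`. -/

theorem mem_space {x : E n} : x ∈ space n ↔ ‖x‖ < 1 := by
  simp [space]

theorem one_sub_norm_sq_pos {x : E n} (hx : x ∈ space n) : 0 < 1 - ‖x‖ ^ 2 := by
  have h := mem_space.1 hx
  nlinarith [norm_nonneg x]

theorem metric_add_left (x w w' u : E n) : metric x (w + w') u = metric x w u + metric x w' u := by
  simp only [metric, inner_add_left, inner_add_right]
  ring

theorem metric_smul_left (x w u : E n) (r : ℝ) : metric x (r • w) u = r * metric x w u := by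
  simp only [metric, real_inner_smul_left, real_inner_smul_right]
  ring

theorem eq_zero_of_metric_self {x : E n} (hx : x ∈ space n) {w : E n} (h : metric x w w = 0) :
    w = 0 := by
  have hQ := one_sub_norm_sq_pos hx
  by_contra hw
  have h1 : 0 < inner ℝ w w := real_inner_self_pos.2 hw
  have h2 := mul_self_nonneg (inner ℝ x w)
  have : 0 < metric x w w := by unfold metric; positivity
  exact this.ne' h

/-- The directional derivative of the metric coefficients. -/
theorem fderiv_metric {x : E n} (hx : x ∈ space n) (a b u : E n) :
    fderiv ℝ (fun y => metric y b u) x a =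
      2 * inner ℝ x a * inner ℝ b u / (1 - ‖x‖ ^ 2) ^ 2
        + (inner ℝ a b * inner ℝ x u + inner ℝ x b * inner ℝ a u) / (1 - ‖x‖ ^ 2) ^ 2
        + 4 * inner ℝ x a * inner ℝ x b * inner ℝ x u / (1 - ‖x‖ ^ 2) ^ 3 := by
  have hQ := (one_sub_norm_sq_pos hx).ne'
  have hd : DifferentiableAt ℝ (fun y => metric y b u) x := by
    unfold metric
    have hn : DifferentiableAt ℝ (fun y : E n => 1 - ‖y‖ ^ 2) x :=
      (differentiableAt_const _).sub (differentiableAt_id.norm_sq ℝ)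
    have hbu : DifferentiableAt ℝ (fun y : E n => (inner ℝ y b * inner ℝ y u : ℝ)) x :=
      (differentiableAt_id.inner ℝ (differentiableAt_const b)).fun_mul
        (differentiableAt_id.inner ℝ (differentiableAt_const u))
    have hn2 : DifferentiableAt ℝ (fun y : E n => (1 - ‖y‖ ^ 2) ^ 2) x := hn.fun_pow 2
    simp only [div_eq_mul_inv]
    exact ((differentiableAt_const _).fun_mul (hn.fun_inv hQ)).fun_add
      (hbu.fun_mul (hn2.fun_inv (pow_ne_zero 2 hQ)))
  rw [← hd.lineDeriv_eq_fderiv, lineDeriv]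
  have hl : HasDerivAt (fun t : ℝ => x + t • a) a 0 := by
    simpa using ((hasDerivAt_id (0 : ℝ)).smul_const a).const_add x
  have hq : HasDerivAt (fun t : ℝ => 1 - ‖x + t • a‖ ^ 2) (-(2 * inner ℝ x a)) 0 := by
    simpa using hl.norm_sq.const_sub 1
  have hb : HasDerivAt (fun t : ℝ => inner ℝ (x + t • a) b) (inner ℝ a b) 0 := by
    simpa using hl.inner ℝ (hasDerivAt_const (0 : ℝ) b)
  have hu : HasDerivAt (fun t : ℝ => inner ℝ (x + t • a) u) (inner ℝ a u) 0 := by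
    simpa using hl.inner ℝ (hasDerivAt_const (0 : ℝ) u)
  have hQ0 : 1 - ‖x + (0 : ℝ) • a‖ ^ 2 ≠ 0 := by simpa using hQ
  have key := ((hasDerivAt_const (0 : ℝ) (inner ℝ b u : ℝ)).fun_div hq hQ0).fun_add
    ((hb.fun_mul hu).fun_div (hq.fun_pow 2) (pow_ne_zero 2 hQ0))
  refine key.deriv.trans ?_
  simp only [zero_smul, add_zero]
  field_simp
  ring

/-- The geodesic equation in terms of the acceleration. -/
theorem christoffel_self {x : E n} (hx : x ∈ space n) (a u : E n) :
    christoffel x a a u = metric x ((2 * inner ℝ x a / (1 - ‖x‖ ^ 2)) • a) u := by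
  have hQ := (one_sub_norm_sq_pos hx).ne'
  rw [christoffel, fderiv_metric hx, fderiv_metric hx, metric_smul_left, metric,
    real_inner_comm u a]
  field_simp
  ring

/-- A curve is a geodesic iff `γ' / (1 - |γ|²)` is constant. -/
theorem isGeodesic_iff {γ : ℝ → E n} :
    IsGeodesic γ ↔ ContDiff ℝ 2 γ ∧ (∀ t, γ t ∈ space n) ∧
      ∃ k : E n, ∀ t, deriv γ t = (1 - ‖γ t‖ ^ 2) • k := by
  constructor
  · intro h
    refine ⟨h.contDiff, h.mem_space, ?_⟩
    have hγ : ∀ t, HasDerivAt γ (deriv γ t) t := fun t =>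
      (h.contDiff.differentiable (by norm_num) t).hasDerivAt
    have hγ' : ∀ t, HasDerivAt (deriv γ) (deriv (deriv γ) t) t := fun t =>
      (((contDiff_succ_iff_deriv (n := 1)).1 h.contDiff).2.2.differentiable (by norm_num) t).hasDerivAt
    -- The equation holds against every `u`; testing it with `u` equal to the left side itself and
    -- using definiteness isolates the acceleration.
    have hacc : ∀ t, deriv (deriv γ) t
        + (2 * inner ℝ (γ t) (deriv γ t) / (1 - ‖γ t‖ ^ 2)) • deriv γ t = 0 := fun t => by
      have := h.equation t (deriv (deriv γ) t
        + (2 * inner ℝ (γ t) (deriv γ t) / (1 - ‖γ t‖ ^ 2)) • deriv γ t)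
      rw [christoffel_self (h.mem_space t), ← metric_add_left] at this
      exact eq_zero_of_metric_self (h.mem_space t) this
    have hQ : ∀ t, 1 - ‖γ t‖ ^ 2 ≠ 0 := fun t => (one_sub_norm_sq_pos (h.mem_space t)).ne'
    have hd : ∀ t, HasDerivAt (fun t => (1 - ‖γ t‖ ^ 2)⁻¹ • deriv γ t) 0 t := fun t => by
      have h1 := (((hγ t).norm_sq.const_sub 1).fun_inv (hQ t)).fun_smul (hγ' t)
      refine h1.congr_deriv ?_
      rw [eq_neg_of_add_eq_zero_left (hacc t), smul_neg, smul_smul, ← neg_smul, ← add_smul]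
      convert! zero_smul ℝ _
      have := hQ t
      field_simp
      ring
    refine ⟨(1 - ‖γ 0‖ ^ 2)⁻¹ • deriv γ 0, fun t => ?_⟩
    rw [← is_const_of_deriv_eq_zero (fun t => (hd t).differentiableAt) (fun t => (hd t).deriv) t 0,
      smul_inv_smul₀ (hQ t)]
  · rintro ⟨hc, hs, k, hk⟩
    refine ⟨hc, hs, fun t u => ?_⟩
    have hQ := (one_sub_norm_sq_pos (hs t)).ne'
    have hγ : HasDerivAt γ (deriv γ t) t := (hc.differentiable (by norm_num) t).hasDerivAt
    have h2 : deriv (deriv γ) t = (-(2 * inner ℝ (γ t) (deriv γ t))) • k := by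
      have h3 := ((hγ.norm_sq.const_sub 1).smul_const k).deriv
      rwa [← funext hk] at h3
    rw [christoffel_self (hs t), ← metric_add_left, h2]
    conv_lhs => enter [2, 2, 2]; rw [hk t]
    rw [smul_smul, div_mul_cancel₀ _ hQ, ← add_smul, neg_add_cancel, zero_smul]
    simp [metric]

/-- A geodesic with constant `γ' / (1 - |γ|²) = k` moves by a positive multiple of `k`. -/
theorem exists_sub_eq_smul {γ : ℝ → E n} (hc : ContDiff ℝ 2 γ) (hs : ∀ t, γ t ∈ space n) {k : E n}
    (hk : ∀ t, deriv γ t = (1 - ‖γ t‖ ^ 2) • k) (t : ℝ) :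
    ∃ r : ℝ, γ t - γ 0 = r • k ∧ (0 < t → 0 < r) := by
  have hcont : Continuous fun t => 1 - ‖γ t‖ ^ 2 :=
    continuous_const.sub (hc.continuous.norm.pow 2)
  refine ⟨∫ s in (0 : ℝ)..t, (1 - ‖γ s‖ ^ 2), ?_, fun ht => ?_⟩
  · rw [← intervalIntegral.integral_smul_const, ← intervalIntegral.integral_eq_sub_of_hasDerivAt
      (f := γ) (f' := deriv γ) (fun s _ => (hc.differentiable (by norm_num) s).hasDerivAt)]
    · simp_rw [hk]
    · rw [funext hk]
      exact (hcont.smul continuous_const).intervalIntegrable _ _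
  · exact intervalIntegral.intervalIntegral_pos_of_pos (hcont.intervalIntegrable _ _)
      (fun s => one_sub_norm_sq_pos (hs s)) ht

end Geodesics

/-! ### Geodesics on a chord of the ball -/

section Chord

variable {n : ℕ}

theorem hasDerivAt_tanh (t : ℝ) : HasDerivAt Real.tanh (1 - Real.tanh t ^ 2) t := by
  have hc := (Real.cosh_pos t).ne'
  have h := (Real.hasDerivAt_sinh t).fun_div (Real.hasDerivAt_cosh t) hc
  rw [show Real.tanh = fun t => Real.sinh t / Real.cosh t from funext Real.tanh_eq_sinh_div_cosh]
  refine h.congr_deriv ?_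
  field_simp

theorem contDiff_tanh {m : WithTop ℕ∞} : ContDiff ℝ m Real.tanh := by
  rw [show Real.tanh = fun t => Real.sinh t / Real.cosh t from funext Real.tanh_eq_sinh_div_cosh]
  exact Real.contDiff_sinh.div Real.contDiff_cosh fun t => (Real.cosh_pos t).ne'

theorem hasDerivAt_artanh {s : ℝ} (hs : s ∈ Ioo (-1 : ℝ) 1) :
    HasDerivAt Real.artanh (1 / (1 - s ^ 2)) s := by
  have h1 : 1 + s ≠ 0 := by linarith [hs.1]
  have h2 : 1 - s ≠ 0 := by linarith [hs.2]
  have h := ((((hasDerivAt_id s).const_add 1).fun_div ((hasDerivAt_id s).const_sub 1) h2).log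
    (div_ne_zero h1 h2)).const_mul (1 / 2)
  refine (h.congr_of_eventuallyEq ?_).congr_deriv ?_
  · filter_upwards [Ioo_mem_nhds hs.1 hs.2] with r hr
    simpa using Real.artanh_eq_half_log (Ioo_subset_Icc_self hr)
  · have h3 : 1 - s ^ 2 ≠ 0 := by
      rw [show 1 - s ^ 2 = (1 + s) * (1 - s) by ring]; exact mul_ne_zero h1 h2
    simp only [id]
    field_simp
    ring

/-- The points of a chord, given by its foot `m`, its unit direction `e` and its half length `h`. -/
structure IsChord (m e : E n) (h : ℝ) : Prop where
  norm_eq_one : ‖e‖ = 1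
  inner_eq_zero : inner ℝ m e = 0
  pos : 0 < h
  sq_eq : h ^ 2 = 1 - ‖m‖ ^ 2

variable {m e : E n} {h : ℝ}

theorem IsChord.one_sub_norm_sq (H : IsChord m e h) (τ : ℝ) :
    1 - ‖m + τ • e‖ ^ 2 = h ^ 2 - τ ^ 2 := by
  rw [norm_add_sq_real, real_inner_smul_right, H.inner_eq_zero, norm_smul, H.norm_eq_one, H.sq_eq,
    Real.norm_eq_abs, mul_one, sq_abs]
  ring

theorem IsChord.mem_space_iff (H : IsChord m e h) {τ : ℝ} :
    m + τ • e ∈ space n ↔ τ / h ∈ Ioo (-1 : ℝ) 1 := by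
  have h1 := H.one_sub_norm_sq τ
  rw [mem_space, mem_Ioo, lt_div_iff₀ H.pos, div_lt_iff₀ H.pos, neg_one_mul, one_mul, ← abs_lt,
    ← sq_lt_sq₀ (norm_nonneg _) zero_le_one, ← sq_lt_sq₀ (abs_nonneg τ) H.pos.le, sq_abs]
  constructor <;> intro _ <;> linarith

theorem IsChord.tanh_mem_space (H : IsChord m e h) (s : ℝ) :
    m + (h * Real.tanh s) • e ∈ space n := by
  rw [H.mem_space_iff, mul_div_cancel_left₀ _ H.pos.ne']
  exact ⟨Real.neg_one_lt_tanh _, Real.tanh_lt_one _⟩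

/-- In the coordinate `τ` along the chord, `γ' / (1 - |γ|²)` is constant exactly when `τ'` is a
constant multiple of `h² - τ²`; `h tanh` solves this. -/
theorem IsChord.deriv_geodesic (H : IsChord m e h) (l a t : ℝ) :
    deriv (fun t => m + (h * Real.tanh (l * t + a)) • e) t =
      (1 - ‖m + (h * Real.tanh (l * t + a)) • e‖ ^ 2) • (l / h) • e := by
  have hpos := H.pos
  have h1 : HasDerivAt (fun t : ℝ => l * t + a) l t := by
    simpa using ((hasDerivAt_id t).const_mul l).add_const a
  have h2 := ((((hasDerivAt_tanh _).comp t h1).const_mul h).smul_const e).const_add m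
  rw [H.one_sub_norm_sq, smul_smul]
  refine h2.deriv.trans ?_
  congr 1
  field_simp

theorem IsChord.geodesic (H : IsChord m e h) (l a : ℝ) :
    IsGeodesic fun t => m + (h * Real.tanh (l * t + a)) • e := by
  refine isGeodesic_iff.2 ⟨?_, fun t => H.tanh_mem_space _, (l / h) • e, H.deriv_geodesic l a⟩
  refine contDiff_const.add (ContDiff.fun_smul ?_ contDiff_const)
  exact contDiff_const.mul (contDiff_tanh.comp ((contDiff_const.mul contDiff_id).add contDiff_const))

/-- The hyperbolic arc length coordinate of a geodesic on a chord is affine in time. -/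
theorem IsChord.artanh_geodesic (H : IsChord m e h) {γ : ℝ → E n} (hc : ContDiff ℝ 2 γ)
    (hs : ∀ t, γ t ∈ space n) {r : ℝ} (hk : ∀ t, deriv γ t = (1 - ‖γ t‖ ^ 2) • r • e)
    {τ : ℝ → ℝ} (hτ : ∀ t, γ t = m + τ t • e) (t : ℝ) :
    Real.artanh (τ t / h) = (r * h) * t + Real.artanh (τ 0 / h) := by
  have hpos := H.pos
  -- Pairing with `e` gives `τ' = r (h² - τ²)`, so `artanh (τ / h)` has constant derivative `r h`.
  have hτ' : ∀ t, HasDerivAt τ ((h ^ 2 - τ t ^ 2) * r) t := fun t => by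
    have h1 := ((hc.differentiable (by norm_num) t).hasDerivAt).inner ℝ (hasDerivAt_const t e)
    have h2 : (fun t => inner ℝ (γ t) e) = τ := by
      funext t
      rw [hτ, inner_add_left, H.inner_eq_zero, real_inner_smul_left, real_inner_self_eq_norm_sq,
        H.norm_eq_one]
      ring
    rw [h2] at h1
    refine h1.congr_deriv ?_
    rw [hk, hτ t, H.one_sub_norm_sq, inner_zero_right, real_inner_smul_left, real_inner_smul_left,
      real_inner_self_eq_norm_sq, H.norm_eq_one]
    ring
  have hmem : ∀ t, τ t / h ∈ Ioo (-1 : ℝ) 1 := fun t => H.mem_space_iff.1 (hτ t ▸ hs t)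
  have hd : ∀ t, HasDerivAt (fun t => Real.artanh (τ t / h) - (r * h) * t) 0 t := fun t => by
    have h1 := ((hasDerivAt_artanh (hmem t)).comp t ((hτ' t).div_const h)).sub
      ((hasDerivAt_id t).const_mul (r * h))
    refine h1.congr_deriv ?_
    have h3 : 1 - (τ t / h) ^ 2 ≠ 0 := by nlinarith [(hmem t).1, (hmem t).2]
    have h4 : h ^ 2 - τ t ^ 2 ≠ 0 := by
      rw [← H.one_sub_norm_sq, ← hτ]; exact (one_sub_norm_sq_pos (hs t)).ne'
    field_simp
    ring
  have := is_const_of_deriv_eq_zero (fun t => (hd t).differentiableAt) (fun t => (hd t).deriv) t 0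
  simp only [mul_zero, sub_zero] at this
  linarith

/-- Any two points of the ball lie on a common chord. -/
theorem exists_isChord (hn : 1 ≤ n) {x : E n} (hx : x ∈ space n) (y : E n) :
    ∃ (m e : E n) (h a b : ℝ), IsChord m e h ∧ x = m + a • e ∧ y = m + b • e := by
  obtain ⟨e, r, he, hr⟩ : ∃ (e : E n) (r : ℝ), ‖e‖ = 1 ∧ y - x = r • e := by
    by_cases hxy : y - x = 0
    -- For coincident points any direction serves, and one exists because `n ≥ 1`.
    · have : Nonempty (Fin n) := ⟨⟨0, hn⟩⟩
      obtain ⟨e, he⟩ := exists_norm_eq (E n) zero_le_one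
      exact ⟨e, 0, he, by simpa using hxy⟩
    · refine ⟨‖y - x‖⁻¹ • (y - x), ‖y - x‖, norm_smul_inv_norm hxy, ?_⟩
      rw [smul_inv_smul₀ (norm_ne_zero_iff.2 hxy)]
  have hee : inner ℝ e e = (1 : ℝ) := by rw [real_inner_self_eq_norm_sq, he, one_pow]
  have hme : inner ℝ (x - inner ℝ x e • e) e = (0 : ℝ) := by
    rw [inner_sub_left, real_inner_smul_left, hee, mul_one, sub_self]
  have hm : 0 < 1 - ‖x - inner ℝ x e • e‖ ^ 2 := by
    have h1 : ‖(x - inner ℝ x e • e) + inner ℝ x e • e‖ ^ 2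
        = ‖x - inner ℝ x e • e‖ ^ 2 + inner ℝ x e ^ 2 := by
      rw [norm_add_sq_real, real_inner_smul_right, hme, norm_smul, he, Real.norm_eq_abs, mul_one,
        sq_abs]
      ring
    rw [sub_add_cancel] at h1
    nlinarith [one_sub_norm_sq_pos hx]
  -- The foot `m` is the orthogonal projection of the origin onto the line.
  refine ⟨x - inner ℝ x e • e, e, √(1 - ‖x - inner ℝ x e • e‖ ^ 2), inner ℝ x e, inner ℝ x e + r,
    ⟨he, hme, Real.sqrt_pos.2 hm, Real.sq_sqrt hm.le⟩, by simp, ?_⟩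
  rw [add_smul, ← add_assoc, sub_add_cancel, ← hr, add_sub_cancel]

/-- The geodesic of a chord joining two of its points. -/
theorem IsChord.exists_geodesic (H : IsChord m e h) {a b : ℝ} (ha : m + a • e ∈ space n)
    (hb : m + b • e ∈ space n) :
    ∃ l s : ℝ, a = h * Real.tanh s ∧ b = h * Real.tanh (l + s) := by
  refine ⟨Real.artanh (b / h) - Real.artanh (a / h), Real.artanh (a / h), ?_, ?_⟩
  · rw [Real.tanh_artanh (H.mem_space_iff.1 ha), mul_div_cancel₀ _ H.pos.ne']
  · rw [sub_add_cancel, Real.tanh_artanh (H.mem_space_iff.1 hb), mul_div_cancel₀ _ H.pos.ne']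

/-- A geodesic joining two points of a chord stays on the chord. -/
theorem IsChord.exists_coord (H : IsChord m e h) {γ : ℝ → E n} (hγ : IsGeodesic γ) {a b : ℝ}
    (h0 : γ 0 = m + a • e) (h1 : γ 1 = m + b • e) :
    ∃ (τ : ℝ → ℝ) (r : ℝ), (∀ t, γ t = m + τ t • e) ∧ τ 0 = a ∧ τ 1 = b ∧
      ∀ t, Real.artanh (τ t / h) = (r * h) * t + Real.artanh (a / h) := by
  obtain ⟨hc, hs, k, hk⟩ := isGeodesic_iff.1 hγ
  obtain ⟨r, hr, hr0⟩ := exists_sub_eq_smul hc hs hk 1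
  have hr0 := hr0 one_pos
  -- The displacement over `[0, 1]` is `r • k` and also `(b - a) • e`, so the constant velocity
  -- vector points along the chord.
  have hke : k = (r⁻¹ * (b - a)) • e := by
    rw [h0, h1, add_sub_add_left_eq_sub, ← sub_smul] at hr
    rw [mul_smul, hr, inv_smul_smul₀ hr0.ne']
  have hcoord : ∀ t, ∃ τ : ℝ, γ t = m + τ • e := fun t => by
    obtain ⟨q, hq, -⟩ := exists_sub_eq_smul hc hs hk t
    refine ⟨a + q * (r⁻¹ * (b - a)), ?_⟩
    rw [sub_eq_iff_eq_add.1 hq, h0, hke, smul_smul]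
    module
  choose τ hτ using hcoord
  have hinj : ∀ {p q : ℝ}, m + p • e = m + q • e → p = q := fun {p q} hpq => by
    have he : e ≠ 0 := by
      intro h0
      have := H.norm_eq_one
      simp [h0] at this
    exact smul_left_injective ℝ he (add_left_cancel hpq)
  have e0 : τ 0 = a := hinj ((hτ 0).symm.trans h0)
  have e1 : τ 1 = b := hinj ((hτ 1).symm.trans h1)
  refine ⟨τ, r⁻¹ * (b - a), hτ, e0, e1, fun t => ?_⟩
  rw [← e0]
  exact H.artanh_geodesic hc hs (fun t => by rw [hk, hke, e0]) hτ t

end Chord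

/-- Through two points of the ball there is exactly one geodesic. -/
theorem IsGeodesic.unique {n : ℕ} (hn : 1 ≤ n) {γ γ' : ℝ → E n} (hγ : IsGeodesic γ)
    (hγ' : IsGeodesic γ') (h0 : γ 0 = γ' 0) (h1 : γ 1 = γ' 1) : γ = γ' := by
  obtain ⟨m, e, h, a, b, H, hx, hy⟩ := exists_isChord hn (hγ.mem_space 0) (γ 1)
  obtain ⟨τ, r, hτ, -, e1, hr⟩ := H.exists_coord hγ hx hy
  obtain ⟨τ', r', hτ', -, e1', hr'⟩ := H.exists_coord hγ' (h0 ▸ hx) (h1 ▸ hy)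
  -- The values at times 0 and 1 determine the slope of the affine function `artanh (τ / h)`.
  have hrr : r * h = r' * h := by
    have h2 := hr 1
    have h3 := hr' 1
    rw [e1] at h2
    rw [e1'] at h3
    linarith
  funext t
  have h4 : Real.artanh (τ t / h) = Real.artanh (τ' t / h) := by rw [hr, hr', hrr]
  have h5 := Real.artanh_injOn (H.mem_space_iff.1 (hτ t ▸ hγ.mem_space t))
    (H.mem_space_iff.1 (hτ' t ▸ hγ'.mem_space t)) h4
  rw [hτ, hτ', (div_left_inj' H.pos.ne').1 h5]

end Klein

namespace Klein

/-! ### Length-minimizing geodesics -/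

section Minimizing

variable {n : ℕ}

/-- The Busemann function of the ideal point `ω`. -/
noncomputable def busemann (ω p : E n) : ℝ := Real.log (1 - inner ℝ p ω) - 1 / 2 * Real.log (1 - ‖p‖ ^ 2)

/-- The differential of the Busemann function of `ω` at `p`, applied to `u`. -/
noncomputable def busemannDeriv (ω p u : E n) : ℝ :=
  -inner ℝ u ω / (1 - inner ℝ p ω) + inner ℝ p u / (1 - ‖p‖ ^ 2)

theorem one_sub_inner_pos {p ω : E n} (hp : p ∈ space n) (hω : ‖ω‖ = 1) : 0 < 1 - inner ℝ p ω := by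
  have h1 := real_inner_le_norm p ω
  rw [hω, mul_one] at h1
  linarith [mem_space.1 hp]

theorem hasDerivAt_busemann {η : ℝ → E n} {u ω : E n} {t : ℝ} (hη : HasDerivAt η u t)
    (hs : η t ∈ space n) (hω : ‖ω‖ = 1) :
    HasDerivAt (fun t => busemann ω (η t)) (busemannDeriv ω (η t) u) t := by
  have hQ := one_sub_norm_sq_pos hs
  have hI := one_sub_inner_pos hs hω
  have h1 := ((hη.inner ℝ (hasDerivAt_const t ω)).const_sub 1).log hI.ne'
  have h2 := ((hη.norm_sq.const_sub 1).log hQ.ne').const_mul (1 / 2)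
  refine (h1.sub h2).congr_deriv ?_
  rw [busemannDeriv, inner_zero_right, zero_add]
  field_simp
  ring

/-- The Busemann function has gradient of length at most one. -/
theorem abs_busemannDeriv_le {p ω : E n} (hp : p ∈ space n) (hω : ‖ω‖ = 1) (u : E n) :
    |busemannDeriv ω p u| ≤ √(metric p u u) := by
  have hQ := one_sub_norm_sq_pos hp
  have hI := one_sub_inner_pos hp hω
  refine Real.abs_le_sqrt ?_
  set a : ℝ := inner ℝ u ω / (1 - inner ℝ p ω) with ha
  have ha' : inner ℝ u ω = a * (1 - inner ℝ p ω) := by rw [ha, div_mul_cancel₀ _ hI.ne']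
  -- Cauchy–Schwarz for `u + a • p` against the unit vector `ω`; the coefficient `a` is chosen so
  -- that this inner product is `a` again.
  have h1 : a ^ 2 ≤ ‖u‖ ^ 2 + 2 * a * inner ℝ p u + a ^ 2 * ‖p‖ ^ 2 := by
    have h2 : inner ℝ (u + a • p) ω = a := by
      rw [inner_add_left, real_inner_smul_left, ha']; ring
    have h3 := abs_real_inner_le_norm (u + a • p) ω
    rw [h2, hω, mul_one] at h3
    have h4 := sq_le_sq' (by linarith [neg_abs_le a, norm_nonneg (u + a • p)])
      ((le_abs_self a).trans h3)
    rw [norm_add_sq_real, real_inner_smul_right, norm_smul, mul_pow, Real.norm_eq_abs, sq_abs,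
      real_inner_comm] at h4
    linarith
  have h5 : busemannDeriv ω p u = -a + inner ℝ p u / (1 - ‖p‖ ^ 2) := by
    rw [busemannDeriv, neg_div]
  rw [h5, metric, real_inner_self_eq_norm_sq, ← sub_nonneg]
  have h6 : ‖u‖ ^ 2 / (1 - ‖p‖ ^ 2) + inner ℝ p u * inner ℝ p u / (1 - ‖p‖ ^ 2) ^ 2
      - (-a + inner ℝ p u / (1 - ‖p‖ ^ 2)) ^ 2
      = (‖u‖ ^ 2 + 2 * a * inner ℝ p u + a ^ 2 * ‖p‖ ^ 2 - a ^ 2) / (1 - ‖p‖ ^ 2) := by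
    field_simp
    ring
  rw [h6]
  exact div_nonneg (by linarith) hQ.le

/-- A curve is at least as long as the variation of a Busemann function between its ends. -/
theorem abs_busemann_sub_le_length {η : ℝ → E n} {ω : E n} (hω : ‖ω‖ = 1) (hη : ContDiff ℝ 1 η)
    (hs : ∀ t ∈ Icc (0 : ℝ) 1, η t ∈ space n) :
    |busemann ω (η 1) - busemann ω (η 0)| ≤ length η := by
  have hd : Continuous (deriv η) := hη.continuous_deriv le_rfl
  have hc := hη.continuous
  have hQc : ContinuousOn (fun t => 1 - ‖η t‖ ^ 2) (Icc 0 1) := by fun_prop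
  have hQ : ∀ t ∈ Icc (0 : ℝ) 1, 1 - ‖η t‖ ^ 2 ≠ 0 := fun t ht => (one_sub_norm_sq_pos (hs t ht)).ne'
  have hI : ∀ t ∈ Icc (0 : ℝ) 1, 1 - inner ℝ (η t) ω ≠ 0 := fun t ht =>
    (one_sub_inner_pos (hs t ht) hω).ne'
  have huIcc : uIcc (0 : ℝ) 1 = Icc 0 1 := uIcc_of_le zero_le_one
  have hD : ContinuousOn (fun t => busemannDeriv ω (η t) (deriv η t)) (Icc 0 1) := by
    refine ContinuousOn.add (ContinuousOn.div ?_ ?_ hI) (ContinuousOn.div ?_ hQc hQ)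
    · exact ((hd.inner continuous_const).neg).continuousOn
    · exact (continuous_const.sub (hc.inner continuous_const)).continuousOn
    · exact (hc.inner hd).continuousOn
  have hM : ContinuousOn (fun t => √(metric (η t) (deriv η t) (deriv η t))) (Icc 0 1) := by
    refine (ContinuousOn.add (ContinuousOn.div ?_ hQc hQ) (ContinuousOn.div ?_ (hQc.pow 2)
      fun t ht => pow_ne_zero 2 (hQ t ht))).sqrt
    · exact (hd.inner hd).continuousOn
    · exact ((hc.inner hd).mul (hc.inner hd)).continuousOn
  rw [← intervalIntegral.integral_eq_sub_of_hasDerivAt (f := fun t => busemann ω (η t))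
    (f' := fun t => busemannDeriv ω (η t) (deriv η t))
    (fun t ht => hasDerivAt_busemann (hη.differentiable (by norm_num) t).hasDerivAt
      (hs t (huIcc ▸ ht)) hω) (hD.intervalIntegrable_of_Icc zero_le_one)]
  refine (intervalIntegral.abs_integral_le_integral_abs zero_le_one).trans ?_
  exact intervalIntegral.integral_mono_on zero_le_one
    (hD.abs.intervalIntegrable_of_Icc zero_le_one) (hM.intervalIntegrable_of_Icc zero_le_one)
    fun t ht => abs_busemannDeriv_le (hs t ht) hω _

variable {m e : E n} {h : ℝ}

theorem IsChord.length_geodesic (H : IsChord m e h) (l a : ℝ) :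
    length (fun t => m + (h * Real.tanh (l * t + a)) • e) = |l| := by
  have hpos := H.pos
  have h1 : ∀ t : ℝ, √(metric (m + (h * Real.tanh (l * t + a)) • e)
      (deriv (fun t => m + (h * Real.tanh (l * t + a)) • e) t)
      (deriv (fun t => m + (h * Real.tanh (l * t + a)) • e) t)) = |l| := fun t => by
    have hQ := one_sub_norm_sq_pos (H.tanh_mem_space (l * t + a))
    have h2 := H.one_sub_norm_sq (h * Real.tanh (l * t + a))
    rw [H.deriv_geodesic, ← Real.sqrt_sq_eq_abs, metric]
    congr 1
    rw [h2, smul_smul]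
    rw [h2] at hQ
    generalize Real.tanh (l * t + a) = T at hQ
    have hT : h ^ 2 - (h * T) ^ 2 = h ^ 2 * (1 - T ^ 2) := by ring
    have hT' : 1 - T ^ 2 ≠ 0 := by
      rw [hT] at hQ
      exact (pos_of_mul_pos_right hQ (sq_nonneg h)).ne'
    simp only [inner_add_left, real_inner_smul_left, real_inner_smul_right, H.inner_eq_zero,
      real_inner_self_eq_norm_sq, norm_smul, mul_pow, Real.norm_eq_abs, sq_abs, H.norm_eq_one]
    field_simp
    ring
  simp only [length, h1]
  simp

theorem IsChord.norm_ideal (H : IsChord m e h) : ‖m + h • e‖ = 1 := by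
  have h1 := H.one_sub_norm_sq h
  rw [← sq_eq_sq₀ (norm_nonneg _) zero_le_one]
  linarith

/-- Along the chord ending at `ω` the Busemann function is minus arc length up to a constant, so the
Lipschitz bound is attained there. -/
theorem IsChord.busemann_tanh (H : IsChord m e h) (s : ℝ) :
    busemann (m + h • e) (m + (h * Real.tanh s) • e) = Real.log h - s := by
  have hpos := H.pos
  have hc := Real.cosh_pos s
  have h1 : 1 - inner ℝ (m + (h * Real.tanh s) • e) (m + h • e)
      = h ^ 2 * (Real.exp (-s) / Real.cosh s) := by
    simp only [inner_add_left, inner_add_right, real_inner_smul_left, real_inner_smul_right,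
      H.inner_eq_zero, real_inner_comm m e, real_inner_self_eq_norm_sq, H.norm_eq_one]
    rw [← Real.cosh_sub_sinh, sub_div, div_self hc.ne', ← Real.tanh_eq_sinh_div_cosh]
    have := H.sq_eq
    linear_combination -this
  have h2 : 1 - ‖m + (h * Real.tanh s) • e‖ ^ 2 = (h / Real.cosh s) ^ 2 := by
    rw [H.one_sub_norm_sq, Real.tanh_eq_sinh_div_cosh]
    field_simp
    linear_combination Real.cosh_sq s
  rw [busemann, h1, h2, Real.log_mul (by positivity) (by positivity), Real.log_div
    (Real.exp_pos _).ne' hc.ne', Real.log_exp, Real.log_pow, Real.log_pow,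
    Real.log_div hpos.ne' hc.ne']
  push_cast
  ring

/-- Calibration: the Busemann function of the chord's ideal endpoint varies by exactly `|l|` between
the two points, and by no more than the length of any competitor. -/
theorem IsChord.isMinGeodesic (H : IsChord m e h) (l a : ℝ) :
    IsMinGeodesic (m + (h * Real.tanh a) • e) (m + (h * Real.tanh (l + a)) • e)
      (fun t => m + (h * Real.tanh (l * t + a)) • e) where
  isGeodesic := H.geodesic l a
  start := by simp
  finish := by simp
  minimizing η hη hs h0 h1 := by
    have h2 := abs_busemann_sub_le_length H.norm_ideal hη hs
    rw [h0, h1, H.busemann_tanh, H.busemann_tanh] at h2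
    rw [H.length_geodesic]
    refine le_trans (le_of_eq ?_) h2
    rw [← abs_neg]
    congr 1
    ring

theorem monotone_tanh : Monotone Real.tanh :=
  monotone_of_deriv_nonneg (fun t => (hasDerivAt_tanh t).differentiableAt) fun t => by
    rw [(hasDerivAt_tanh t).deriv]
    nlinarith [Real.tanh_lt_one t, Real.neg_one_lt_tanh t]

/-- Any two points of the ball are joined by a unique minimizing geodesic, which runs on the
segment between them. -/
theorem exists_unique_isMinGeodesic (hn : 1 ≤ n) {x y : E n} (hx : x ∈ space n)
    (hy : y ∈ space n) :
    ∃ γ, IsMinGeodesic x y γ ∧ (∀ γ', IsMinGeodesic x y γ' → γ' = γ) ∧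
      ∀ t ∈ Icc (0 : ℝ) 1, γ t ∈ segment ℝ x y := by
  obtain ⟨m, e, h, a, b, H, rfl, rfl⟩ := exists_isChord hn hx y
  obtain ⟨l, s, rfl, rfl⟩ := H.exists_geodesic hx hy
  refine ⟨_, H.isMinGeodesic l s, fun γ' hγ' => ?_, fun t ht => ?_⟩
  · refine hγ'.isGeodesic.unique hn (H.geodesic l s) ?_ ?_
    · rw [hγ'.start]; simp
    · rw [hγ'.finish]; simp
  · have h1 : h * Real.tanh (l * t + s) ∈ segment ℝ (h * Real.tanh s) (h * Real.tanh (l + s)) := by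
      rw [segment_eq_uIcc]
      have hmono : Monotone fun r => h * Real.tanh r := fun p q hpq =>
        mul_le_mul_of_nonneg_left (monotone_tanh hpq) H.pos.le
      rcases le_total 0 l with hl | hl
      · exact mem_uIcc.2 (Or.inl ⟨hmono (by nlinarith [ht.1]), hmono (by nlinarith [ht.2])⟩)
      · exact mem_uIcc.2 (Or.inr ⟨hmono (by nlinarith [ht.2]), hmono (by nlinarith [ht.1])⟩)
    obtain ⟨p, q, hp, hq, hpq, h2⟩ := h1
    refine ⟨p, q, hp, hq, hpq, ?_⟩
    rw [← h2]
    simp only [smul_eq_mul, smul_add, add_smul, smul_smul]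
    rw [add_add_add_comm, ← add_smul, hpq, one_smul]

/-- Euclidean convex subsets of the ball are geodesically convex. -/
theorem geodesicallyConvex_of_convex (hn : 1 ≤ n) {S : Set (E n)} (hS : S ⊆ space n)
    (hc : Convex ℝ S) : GeodesicallyConvex S := by
  refine ⟨hS, fun x hx y hy => ?_⟩
  obtain ⟨γ, h1, h2, h3⟩ := exists_unique_isMinGeodesic hn (hS hx) (hS hy)
  exact ⟨γ, h1, h2, fun t ht => hc.segment_subset hx hy (h3 t ht)⟩

end Minimizing

/-! ### Halfspaces and centrality -/

section Halfspace

variable {n : ℕ}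

/-- Both `exp_x(w) - x` and `w` are positive multiples of the same constant vector, so they lie on
the same side; every point of the ball is reached by a geodesic from `x`. -/
theorem halfspace_eq (hn : 1 ≤ n) {x : E n} (hx : x ∈ space n) (v : E n) :
    halfspace x v = {y | y ∈ space n ∧ metric x (y - x) v < 0} := by
  have key : ∀ γ : ℝ → E n, IsGeodesic γ → γ 0 = x →
      (metric x (deriv γ 0) v < 0 ↔ metric x (γ 1 - x) v < 0) := fun γ hγ h0 => by
    obtain ⟨hc, hs, k, hk⟩ := isGeodesic_iff.1 hγ
    obtain ⟨r, hr, hr0⟩ := exists_sub_eq_smul hc hs hk 1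
    rw [h0] at hr
    rw [hr, hk, metric_smul_left, metric_smul_left, ← neg_pos, ← neg_pos (a := r * _), ← mul_neg,
      ← mul_neg, mul_pos_iff_of_pos_left (one_sub_norm_sq_pos (hs 0)),
      mul_pos_iff_of_pos_left (hr0 one_pos)]
  ext y
  constructor
  · rintro ⟨w, hw, γ, hγ, h0, rfl, rfl⟩
    exact ⟨hγ.mem_space 1, (key γ hγ h0).1 hw⟩
  · rintro ⟨hy, hv⟩
    obtain ⟨γ, hγ, -, -⟩ := exists_unique_isMinGeodesic hn hx hy
    refine ⟨deriv γ 0, ?_, γ, hγ.isGeodesic, hγ.start, rfl, hγ.finish⟩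
    rw [key γ hγ.isGeodesic hγ.start, hγ.finish]
    exact hv

/-- The part of an open Euclidean halfspace bounded by a hyperplane through `x` in the ball. -/
def euclideanHalfspace (x u : E n) : Set (E n) := {y | y ∈ space n ∧ inner ℝ (y - x) u < 0}

theorem halfspace_eq_euclideanHalfspace (hn : 1 ≤ n) {x : E n} (hx : x ∈ space n) (v : E n) :
    halfspace x v = euclideanHalfspace x
      ((1 - ‖x‖ ^ 2)⁻¹ • v + (inner ℝ x v / (1 - ‖x‖ ^ 2) ^ 2) • x) := by
  rw [halfspace_eq hn hx]
  ext y
  refine and_congr_right fun _ => ?_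
  rw [metric, inner_add_right, real_inner_smul_right, real_inner_smul_right,
    real_inner_comm x (y - x), div_eq_inv_mul, div_mul_eq_mul_div, mul_comm (inner ℝ x v)]

/-- The vector on the right is `G⁻¹ u`, where `G` is the Gram matrix of the metric at `x` and `G⁻¹ =
(1 - |x|²)(I - x xᵀ)`. -/
theorem euclideanHalfspace_eq_halfspace (hn : 1 ≤ n) {x : E n} (hx : x ∈ space n) (u : E n) :
    euclideanHalfspace x u = halfspace x ((1 - ‖x‖ ^ 2) • (u - inner ℝ x u • x)) := by
  have hQ := (one_sub_norm_sq_pos hx).ne'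
  rw [halfspace_eq hn hx]
  ext y
  refine and_congr_right fun _ => ?_
  rw [metric, real_inner_smul_right, real_inner_smul_right, inner_sub_right (y - x) u,
    inner_sub_right x u, real_inner_smul_right, real_inner_smul_right, real_inner_self_eq_norm_sq,
    real_inner_comm (y - x) x]
  have : inner ℝ (y - x) u = (1 - ‖x‖ ^ 2) * (inner ℝ (y - x) u - inner ℝ x u * inner ℝ (y - x) x)
      / (1 - ‖x‖ ^ 2) + inner ℝ (y - x) x * ((1 - ‖x‖ ^ 2) * (inner ℝ x u
        - inner ℝ x u * ‖x‖ ^ 2)) / (1 - ‖x‖ ^ 2) ^ 2 := by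
    field_simp
    ring
  rw [← this]

theorem centrality_eq (hn : 1 ≤ n) (μ : Measure (E n)) {x : E n} (hx : x ∈ space n) :
    centrality μ x = ⨆ u : E n, μ (euclideanHalfspace x u) := by
  refine le_antisymm (iSup_le fun v => ?_) (iSup_le fun u => ?_)
  · rw [halfspace_eq_euclideanHalfspace hn hx]
    exact le_iSup (fun u => μ (euclideanHalfspace x u)) _
  · rw [euclideanHalfspace_eq_halfspace hn hx]
    exact le_iSup (fun u => μ (halfspace x u)) _

theorem halfspace_zero (hn : 1 ≤ n) (v : E n) : halfspace 0 v = euclideanHalfspace 0 v := by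
  rw [halfspace_eq_euclideanHalfspace hn (by simp [space])]
  simp

/-- The largest `β` for which a point is a `β`-centerpoint is determined by its centrality. -/
theorem isGreatest_isCenterpoint (μ : Measure (E n)) [IsFiniteMeasure μ] {c : E n}
    (hc : c ∈ space n) : IsGreatest {b | IsCenterpoint μ b c} (1 - (centrality μ c).toReal) := by
  have hfin : centrality μ c ≠ ⊤ :=
    ne_top_of_le_ne_top (measure_ne_top μ univ) (iSup_le fun v => measure_mono (subset_univ _))
  constructor
  · refine ⟨hc, fun v => ?_⟩
    rw [sub_sub_cancel]
    exact ENNReal.toReal_mono hfin (le_iSup (fun v => μ (halfspace c v)) v)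
  · rintro b ⟨-, hb⟩
    -- Needed so that `ENNReal.ofReal (1 - b)` does not truncate; any direction would do.
    have h0 : 0 ≤ 1 - b := measureReal_nonneg.trans (hb 0)
    have : centrality μ c ≤ ENNReal.ofReal (1 - b) := iSup_le fun v => by
      rw [← ofReal_measureReal]
      exact ENNReal.ofReal_le_ofReal (hb v)
    have := ENNReal.toReal_mono ENNReal.ofReal_ne_top this
    rw [ENNReal.toReal_ofReal h0] at this
    linarith

end Halfspace

end Klein

namespace Klein

/-! ### Regular simplices centred at the origin -/

section Simplex

variable {n : ℕ}

/-- The family `p` of vectors is the vertex set of a regular simplex with circumcentre `0` and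
circumradius `R`. -/
structure IsRegular (p : Fin (n + 1) → E n) (R : ℝ) : Prop where
  one_le : 1 ≤ n
  pos : 0 < R
  norm_eq : ∀ i, ‖p i‖ = R
  exists_isometry : ∀ σ : Equiv.Perm (Fin (n + 1)), ∃ A : E n ≃ₗᵢ[ℝ] E n, ∀ i, A (p i) = p (σ i)
  eq_zero : ∀ z : E n, (∀ i j, inner ℝ (p i) z = inner ℝ (p j) z) → z = 0

theorem isRegular_points (hn : 1 ≤ n) {R : ℝ} (hR : 0 < R) (s : Affine.Simplex ℝ (E n) n)
    (hreg : s.Regular) (hins : ∀ i, ‖s.points i‖ = R) : IsRegular s.points R := by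
  have hspan : ∀ z : E n, (∀ i j, inner ℝ (s.points i) z = inner ℝ (s.points j) z) → z = 0 := by
    intro z hz
    have h1 : vectorSpan ℝ (range s.points) = ⊤ := by
      rw [← direction_affineSpan, s.span_eq_top (by simp), AffineSubspace.direction_top]
    have h2 : z ∈ vectorSpan ℝ (range s.points) := h1 ▸ Submodule.mem_top
    rw [vectorSpan_range_eq_span_range_vsub_right ℝ s.points 0] at h2
    have h3 : ∀ w ∈ Submodule.span ℝ (range fun i => s.points i -ᵥ s.points 0),
        inner ℝ w z = (0 : ℝ) := fun w hw => by
      induction hw using Submodule.span_induction with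
      | mem w hw =>
        obtain ⟨i, rfl⟩ := hw
        simp only [vsub_eq_sub]
        rw [inner_sub_left, hz i 0, sub_self]
      | zero => simp
      | add a b _ _ ha hb => rw [inner_add_left, ha, hb, add_zero]
      | smul r a _ ha => rw [real_inner_smul_left, ha, mul_zero]
    exact inner_self_eq_zero.1 (h3 z h2)
  refine ⟨hn, hR, hins, fun σ => ?_, hspan⟩
  obtain ⟨x, hx⟩ := hreg σ
  have hx' : ∀ i, x (s.points i) = s.points (σ i) := fun i => (congrFun hx i).symm
  -- The image of the origin is at distance `R` from every vertex, so its inner products with the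
  -- vertices agree. An isometry fixing `0` is then linear.
  have h0 : x 0 = 0 := by
    refine hspan _ fun i j => ?_
    have key : ∀ i, 2 * inner ℝ (s.points i) (x 0) = ‖x 0‖ ^ 2 := fun i => by
      have h1 : dist (s.points i) (x 0) = R := by
        rw [← σ.apply_symm_apply i, ← hx', x.dist_eq, dist_zero_right, hins]
      rw [dist_eq_norm] at h1
      have h2 := norm_sub_sq_real (s.points i) (x 0)
      rw [h1, hins] at h2
      linarith
    linarith [key i, key j]
  exact ⟨x.toRealLinearIsometryEquivOfMapZero h0, hx'⟩

namespace IsRegular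

variable {p : Fin (n + 1) → E n} {R : ℝ}

theorem cast_pos (H : IsRegular p R) : (0 : ℝ) < n := by exact_mod_cast H.one_le

/-- The isometry exchanging two vertices fixes the sum, which therefore has equal inner products
with all vertices. -/
theorem sum_eq_zero (H : IsRegular p R) : ∑ i, p i = 0 := by
  refine H.eq_zero _ fun i j => ?_
  obtain ⟨A, hA⟩ := H.exists_isometry (Equiv.swap i j)
  have h1 : A (∑ k, p k) = ∑ k, p k := by
    rw [map_sum]
    simp_rw [hA]
    exact Equiv.sum_comp (Equiv.swap i j) p
  rw [← A.inner_map_map, hA, h1, Equiv.swap_apply_left]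

/-- Symmetries fixing `p i` make its `n` inner products with the other vertices equal; together with
`R ^ 2` they add up to zero. -/
theorem inner_eq (H : IsRegular p R) {i j : Fin (n + 1)} (hij : i ≠ j) :
    inner ℝ (p i) (p j) = -(R ^ 2 / n) := by
  have hconst : ∀ k ∈ Finset.univ.erase i, inner ℝ (p i) (p k) = inner ℝ (p i) (p j) :=
    fun k hk => by
      obtain ⟨A, hA⟩ := H.exists_isometry (Equiv.swap k j)
      have hki := Finset.ne_of_mem_erase hk
      rw [← A.inner_map_map, hA, hA, Equiv.swap_apply_left,
        Equiv.swap_apply_of_ne_of_ne hki.symm hij]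
  have h1 : ∑ k, inner ℝ (p i) (p k) = (0 : ℝ) := by
    rw [← inner_sum, H.sum_eq_zero, inner_zero_right]
  rw [← Finset.add_sum_erase _ _ (Finset.mem_univ i), Finset.sum_congr rfl hconst,
    Finset.sum_const, Finset.card_erase_of_mem (Finset.mem_univ i), Finset.card_univ,
    Fintype.card_fin, add_tsub_cancel_right, nsmul_eq_mul, real_inner_self_eq_norm_sq,
    H.norm_eq] at h1
  have := H.cast_pos
  field_simp
  linarith

theorem sum_inner_eq_zero (H : IsRegular p R) (x : E n) : ∑ i, inner ℝ (p i) x = (0 : ℝ) := by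
  rw [← sum_inner, H.sum_eq_zero, inner_zero_left]

theorem inner_sum_smul (H : IsRegular p R) (c : Fin (n + 1) → ℝ) (i : Fin (n + 1)) :
    inner ℝ (p i) (∑ j, c j • p j) = R ^ 2 / n * ((n + 1) * c i - ∑ j, c j) := by
  have hn := H.cast_pos
  rw [inner_sum]
  simp_rw [real_inner_smul_right]
  have h1 : ∀ j ∈ Finset.univ.erase i, c j * inner ℝ (p i) (p j) = c j * -(R ^ 2 / n) :=
    fun j hj => by rw [H.inner_eq (Finset.ne_of_mem_erase hj).symm]
  rw [← Finset.add_sum_erase _ _ (Finset.mem_univ i), Finset.sum_congr rfl h1, ← Finset.sum_mul,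
    ← Finset.add_sum_erase _ c (Finset.mem_univ i), real_inner_self_eq_norm_sq, H.norm_eq]
  field_simp
  ring

/-- The vertices of a regular simplex form a tight frame. -/
theorem eq_sum (H : IsRegular p R) (x : E n) :
    x = (n / (R ^ 2 * (n + 1))) • ∑ i, inner ℝ (p i) x • p i := by
  have hn := H.cast_pos
  have hR := H.pos
  rw [← sub_eq_zero]
  refine H.eq_zero _ fun i j => ?_
  have h1 : ∀ i, inner ℝ (p i) (x - (n / (R ^ 2 * (n + 1))) • ∑ i, inner ℝ (p i) x • p i) = 0 :=
    fun i => by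
      rw [inner_sub_right, real_inner_smul_right, H.inner_sum_smul, H.sum_inner_eq_zero]
      field_simp
      ring
  rw [h1, h1]

theorem norm_sq_eq (H : IsRegular p R) (x : E n) :
    ‖x‖ ^ 2 = n / (R ^ 2 * (n + 1)) * ∑ i, inner ℝ (p i) x ^ 2 := by
  rw [← real_inner_self_eq_norm_sq]
  nth_rw 2 [H.eq_sum x]
  rw [real_inner_smul_right, inner_sum]
  congr 1
  refine Finset.sum_congr rfl fun i _ => ?_
  rw [real_inner_smul_right, real_inner_comm, sq]

/-- The facet inequalities of a regular simplex. -/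
theorem mem_convexHull_iff (H : IsRegular p R) {x : E n} :
    x ∈ convexHull ℝ (range p) ↔ ∀ i, -(R ^ 2 / n) ≤ inner ℝ (p i) x := by
  have hn := H.cast_pos
  have hR := H.pos
  constructor
  · intro hx i
    have hconv : Convex ℝ {y : E n | -(R ^ 2 / n) ≤ inner ℝ (p i) y} :=
      convex_halfSpace_ge ⟨fun a b => inner_add_right _ _ _, fun r a => real_inner_smul_right _ _ _⟩ _
    refine convexHull_min ?_ hconv hx
    rintro _ ⟨j, rfl⟩
    rcases eq_or_ne i j with rfl | hij
    · rw [mem_ofPred_eq, real_inner_self_eq_norm_sq, H.norm_eq]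
      have : 0 ≤ R ^ 2 / n := by positivity
      nlinarith [sq_nonneg R]
    · exact (H.inner_eq hij).ge
  · intro hx
    have h1 : x = ∑ i, ((n / (R ^ 2 * (n + 1))) * (inner ℝ (p i) x + R ^ 2 / n)) • p i := by
      conv_lhs => rw [H.eq_sum x]
      simp_rw [mul_smul, add_smul]
      rw [← Finset.smul_sum, Finset.sum_add_distrib, ← Finset.smul_sum, H.sum_eq_zero, smul_zero,
        add_zero]
    rw [h1]
    refine (convex_convexHull ℝ _).sum_mem (fun i _ => ?_) ?_
      fun i _ => subset_convexHull ℝ _ (mem_range_self i)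
    · exact mul_nonneg (by positivity) (by linarith [hx i])
    · rw [← Finset.mul_sum, Finset.sum_add_distrib, H.sum_inner_eq_zero, Finset.sum_const,
        Finset.card_univ, Fintype.card_fin, nsmul_eq_mul]
      push_cast
      field_simp
      ring

theorem ball_subset (H : IsRegular p R) : Metric.ball 0 (R / n) ⊆ convexHull ℝ (range p) := by
  intro x hx
  have hR := H.pos
  rw [mem_ball_zero_iff] at hx
  refine H.mem_convexHull_iff.2 fun i => ?_
  have h1 := neg_le_of_abs_le (abs_real_inner_le_norm (p i) x)
  rw [H.norm_eq] at h1
  have h2 : R * ‖x‖ ≤ R * (R / n) := mul_le_mul_of_nonneg_left hx.le hR.le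
  rw [sq, mul_div_assoc]
  linarith

/-- A point of the simplex on or outside the unit sphere lies in the open halfspace towards at
most one vertex, provided that the midpoints of the edges are not too far out. -/
theorem norm_lt_one (H : IsRegular p R) (hR' : ((n : ℝ) - 1) * R ^ 2 ≤ n + 1) {x : E n}
    (hx : x ∈ convexHull ℝ (range p)) {i j : Fin (n + 1)} (hij : i ≠ j)
    (hi : 0 < inner ℝ (p i) x) (hj : 0 < inner ℝ (p j) x) : ‖x‖ < 1 := by
  have hn := H.cast_pos
  have hR := H.pos
  have hx := H.mem_convexHull_iff.1 hx
  set q : ℝ := R ^ 2 / n with hq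
  set c : Fin (n + 1) → ℝ := fun k => inner ℝ (p k) x with hc
  set t : Finset (Fin (n + 1)) := (Finset.univ.erase i).erase j with ht
  have hji : j ∈ Finset.univ.erase i := Finset.mem_erase.2 ⟨hij.symm, Finset.mem_univ _⟩
  have hcard : (t.card : ℝ) = n - 1 := by
    rw [ht, Finset.card_erase_of_mem hji, Finset.card_erase_of_mem (Finset.mem_univ i),
      Finset.card_univ, Fintype.card_fin, add_tsub_cancel_right, Nat.cast_sub H.one_le, Nat.cast_one]
  have hsplit : ∀ f : Fin (n + 1) → ℝ, ∑ k, f k = f i + (f j + ∑ k ∈ t, f k) := fun f => by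
    rw [ht, Finset.add_sum_erase _ _ hji, Finset.add_sum_erase _ _ (Finset.mem_univ i)]
  have hd : ∀ k, 0 ≤ c k + q := fun k => by linarith [hx k]
  have h1 : ∑ k ∈ t, (c k + q) ^ 2 ≤ (∑ k ∈ t, (c k + q)) ^ 2 :=
    Finset.sum_sq_le_sq_sum_of_nonneg fun k _ => hd k
  have h2 : ∑ k ∈ t, (c k + q) = ∑ k ∈ t, c k + (n - 1) * q := by
    rw [Finset.sum_add_distrib, Finset.sum_const, nsmul_eq_mul, hcard]
  have h3 : ∑ k ∈ t, (c k + q) ^ 2 = ∑ k ∈ t, c k ^ 2 + 2 * q * ∑ k ∈ t, c k + (n - 1) * q ^ 2 := by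
    simp_rw [add_sq]
    rw [Finset.sum_add_distrib, Finset.sum_add_distrib, Finset.sum_const, nsmul_eq_mul, hcard,
      Finset.mul_sum]
    congr 2
    exact Finset.sum_congr rfl fun k _ => by ring
  have h4 : c i + (c j + ∑ k ∈ t, c k) = 0 := by rw [← hsplit, H.sum_inner_eq_zero]
  have h0 : 0 ≤ ∑ k ∈ t, (c k + q) := Finset.sum_nonneg fun k _ => hd k
  -- The bound is the value at `(n p i + p j) / (n + 1)`, where the edge meets the hyperplane
  -- orthogonal to `p j`. It is strict because `c i * c j > 0`.
  have h5 : ∑ k, c k ^ 2 < n * (n - 1) * q ^ 2 := by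
    rw [hsplit]
    have hs : ∑ k ∈ t, c k = -(c i + c j) := by linarith
    rw [h2, h3, hs] at h1
    rw [h2, hs] at h0
    have hi' : 0 < c i := hi
    have hj' : 0 < c j := hj
    have hq0 : 0 ≤ q := by positivity
    nlinarith [mul_pos hi' hj', mul_nonneg (add_pos hi' hj').le h0, mul_nonneg hq0 h0]
  have h6 : ‖x‖ ^ 2 < 1 := by
    rw [H.norm_sq_eq]
    have h7 : n / (R ^ 2 * (n + 1)) * ∑ k, c k ^ 2
        < n / (R ^ 2 * (n + 1)) * (n * (n - 1) * q ^ 2) := by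
      exact mul_lt_mul_of_pos_left h5 (by positivity)
    refine h7.trans_le ?_
    rw [hq]
    have h8 : (n : ℝ) / (R ^ 2 * (n + 1)) * (n * (n - 1) * (R ^ 2 / n) ^ 2)
        = ((n : ℝ) - 1) * R ^ 2 / (n + 1) := by
      field_simp
    rw [h8, div_le_one (by positivity)]
    exact hR'
  nlinarith [norm_nonneg x]

/-- A linear isometry permuting the vertices. -/
def _root_.Klein.IsSymmetry (p : Fin (n + 1) → E n) (A : E n ≃ₗᵢ[ℝ] E n) : Prop :=
  ∃ σ : Equiv.Perm (Fin (n + 1)), ∀ i, A (p i) = p (σ i)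

theorem _root_.Klein.IsSymmetry.preimage_convexHull {A : E n ≃ₗᵢ[ℝ] E n} (hA : IsSymmetry p A) :
    A ⁻¹' convexHull ℝ (range p) = convexHull ℝ (range p) := by
  obtain ⟨σ, hσ⟩ := hA
  have h1 : A '' convexHull ℝ (range p) = convexHull ℝ (range p) := by
    have h2 := A.toLinearEquiv.toLinearMap.image_convexHull (range p)
    have h3 : A '' range p = range p := by
      rw [← range_comp, show A ∘ p = p ∘ σ from funext hσ, σ.surjective.range_comp]
    exact h2.trans (congrArg _ h3)
  nth_rw 1 [← h1]
  exact preimage_image_eq _ A.injective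

/-- The rotations of the vertices move every point around the origin. -/
theorem exists_rotations (H : IsRegular p R) :
    ∃ A : Fin (n + 1) → E n ≃ₗᵢ[ℝ] E n, (∀ k i, A k (p i) = p (i + k)) ∧ ∀ x, ∑ k, A k x = 0 := by
  choose A hA using fun k : Fin (n + 1) => H.exists_isometry (Equiv.addRight k)
  refine ⟨A, hA, fun x => ?_⟩
  rw [H.eq_sum x]
  simp_rw [map_smul, map_sum, map_smul, hA]
  rw [← Finset.smul_sum, Finset.sum_comm]
  convert! smul_zero _
  refine Finset.sum_eq_zero fun i _ => ?_
  rw [← Finset.smul_sum]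
  convert! smul_zero _
  exact (Equiv.sum_comp (Equiv.addLeft i) p).trans H.sum_eq_zero

/-- Carry two vertices that distinguish `y` to two that distinguish `v`, then swap the latter: the
point moves by a nonzero multiple of `p k - p l`, which is not orthogonal to `v`. So one of the two
images is not orthogonal to `v` either. -/
theorem exists_inner_ne_zero (H : IsRegular p R) {y v : E n} (hy : y ≠ 0) (hv : v ≠ 0) :
    ∃ A, IsSymmetry p A ∧ inner ℝ (A y) v ≠ (0 : ℝ) := by
  by_contra! hcon
  have h1 : ∃ i j, inner ℝ (p i) y ≠ inner ℝ (p j) y := by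
    by_contra! h; exact hy (H.eq_zero y h)
  have h2 : ∃ k l, inner ℝ (p k) v ≠ inner ℝ (p l) v := by
    by_contra! h; exact hv (H.eq_zero v h)
  obtain ⟨i, j, hij⟩ := h1
  obtain ⟨k, l, hkl⟩ := h2
  have hij' : i ≠ j := fun h => hij (h ▸ rfl)
  have hkl' : k ≠ l := fun h => hkl (h ▸ rfl)
  obtain ⟨σ, hσi, hσj⟩ : ∃ σ : Equiv.Perm (Fin (n + 1)), σ i = k ∧ σ j = l := by
    refine ⟨(Equiv.swap i k).trans (Equiv.swap (Equiv.swap i k j) l), ?_, ?_⟩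
    · rw [Equiv.trans_apply, Equiv.swap_apply_left]
      refine Equiv.swap_apply_of_ne_of_ne (fun h => hij' ?_) hkl'
      exact (Equiv.swap i k).injective ((Equiv.swap_apply_left i k).trans h)
    · rw [Equiv.trans_apply, Equiv.swap_apply_left]
  obtain ⟨A, hA⟩ := H.exists_isometry σ
  obtain ⟨B, hB⟩ := H.exists_isometry (Equiv.swap k l)
  have e1 := hcon A ⟨σ, hA⟩
  have e2 := hcon (A.trans B) ⟨σ.trans (Equiv.swap k l), fun m => by simp [hA, hB]⟩
  have h3 : A y - B (A y) = (n / (R ^ 2 * (n + 1))) •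
      ((inner ℝ (p k) (A y) - inner ℝ (p l) (A y)) • (p k - p l)) := by
    conv_lhs => rw [H.eq_sum (A y)]
    simp_rw [map_smul, map_sum, map_smul, hB]
    rw [← smul_sub, ← Finset.sum_sub_distrib]
    congr 1
    simp_rw [← smul_sub]
    rw [Finset.sum_eq_add k l hkl']
    · rw [Equiv.swap_apply_left, Equiv.swap_apply_right]
      module
    · rintro m - ⟨hmk, hml⟩
      rw [Equiv.swap_apply_of_ne_of_ne hmk hml, sub_self, smul_zero]
    · simp
    · simp
  have h4 : inner ℝ (A y - B (A y)) v = (0 : ℝ) := by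
    rw [inner_sub_left, e1, zero_sub, neg_eq_zero]
    exact e2
  rw [h3, ← hσi, ← hσj, ← hA, ← hA, A.inner_map_map, A.inner_map_map, hA, hA, hσi, hσj,
    real_inner_smul_left, real_inner_smul_left, inner_sub_left] at h4
  have hn := H.cast_pos
  have hR := H.pos
  have h5 : (n : ℝ) / (R ^ 2 * (n + 1)) ≠ 0 := by positivity
  exact mul_ne_zero h5 (mul_ne_zero (sub_ne_zero.2 hij) (sub_ne_zero.2 hkl)) h4

theorem _root_.Klein.IsSymmetry.trans {A B : E n ≃ₗᵢ[ℝ] E n} (hA : IsSymmetry p A)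
    (hB : IsSymmetry p B) : IsSymmetry p (A.trans B) := by
  obtain ⟨σ, hσ⟩ := hA
  obtain ⟨τ, hτ⟩ := hB
  exact ⟨σ.trans τ, fun i => by simp [hσ, hτ]⟩

/-- Some image of a nonzero point under the symmetries lies in a given open halfspace. -/
theorem exists_inner_pos (H : IsRegular p R) {y v : E n} (hy : y ≠ 0) (hv : v ≠ 0) :
    ∃ A, IsSymmetry p A ∧ (0 : ℝ) < inner ℝ (A y) v := by
  obtain ⟨A, hA, hne⟩ := H.exists_inner_ne_zero hy hv
  rcases hne.lt_or_gt with hlt | hgt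
  · obtain ⟨B, hB, hsum⟩ := H.exists_rotations
    by_contra! hcon
    have h1 : ∀ k, inner ℝ (B k (A y)) v ≤ (0 : ℝ) := fun k =>
      hcon (A.trans (B k)) (hA.trans ⟨Equiv.addRight k, hB k⟩)
    have h2 : ∑ k, inner ℝ (B k (A y)) v = (0 : ℝ) := by
      rw [← sum_inner, hsum, inner_zero_left]
    -- The rotation by `0` is the identity, so the nonzero term is among the nonpositive terms
    -- summing to zero.
    have h3 : B 0 (A y) = A y := by
      rw [H.eq_sum (A y)]
      simp_rw [map_smul, map_sum, map_smul, hB, add_zero]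
    have h4 := (Finset.sum_eq_zero_iff_of_nonpos fun k _ => h1 k).1 h2 0 (Finset.mem_univ 0)
    rw [h3] at h4
    exact hne h4
  · exact ⟨A, hA, hgt⟩

end IsRegular

end Simplex

end Klein

namespace Klein

/-! ### The volume of the Klein model -/

section Volume

variable {n : ℕ}

/-- The density of the hyperbolic volume as a function of the Euclidean norm. -/
noncomputable def radialDensity (n : ℕ) (r : ℝ) : ENNReal :=
  ENNReal.ofReal (1 / (1 - r ^ 2) ^ (((n : ℝ) + 1) / 2))

theorem measurable_radialDensity (n : ℕ) : Measurable (radialDensity n) := by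
  unfold radialDensity
  fun_prop

theorem measurableSet_space (n : ℕ) : MeasurableSet (space n) := measurableSet_ball

theorem vol_apply {A : Set (E n)} (hA : MeasurableSet A) (hs : A ⊆ space n) :
    vol n A = ∫⁻ x in A, radialDensity n ‖x‖ := by
  rw [vol, withDensity_apply _ hA, Measure.restrict_restrict hA, inter_eq_left.2 hs]
  rfl

theorem vol_inter_space (A : Set (E n)) : vol n (A ∩ space n) = vol n A := by
  have h0 : vol n (space n)ᶜ = 0 :=
    withDensity_absolutelyContinuous _ _ (by simp [Measure.restrict_apply
      (measurableSet_space n).compl])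
  refine le_antisymm (measure_mono inter_subset_left) ?_
  calc vol n A ≤ vol n ((A ∩ space n) ∪ (space n)ᶜ) :=
        measure_mono fun x hx => by by_cases h : x ∈ space n <;> simp [h, hx]
    _ ≤ vol n (A ∩ space n) + vol n (space n)ᶜ := measure_union_le _ _
    _ = vol n (A ∩ space n) := by rw [h0, add_zero]

theorem vol_absolutelyContinuous (n : ℕ) : vol n ≪ volume :=
  (withDensity_absolutelyContinuous _ _).trans Measure.restrict_le_self.absolutelyContinuous

theorem rpow_pos_of_mem {r : ℝ} (h0 : 0 ≤ r) (h1 : r < 1) (s : ℝ) : 0 < (1 - r ^ 2) ^ s :=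
  Real.rpow_pos_of_pos (by nlinarith) _

theorem one_le_radialDensity {r : ℝ} (h0 : 0 ≤ r) (h1 : r < 1) : 1 ≤ radialDensity n r := by
  rw [radialDensity, ENNReal.one_le_ofReal, le_div_iff₀ (rpow_pos_of_mem h0 h1 _), one_mul]
  exact Real.rpow_le_one (by nlinarith) (by nlinarith) (by positivity)

theorem radialDensity_le {r t : ℝ} (h0 : 0 ≤ r) (hrt : r ≤ t) (h1 : t < 1) :
    radialDensity n r ≤ radialDensity n t := by
  refine ENNReal.ofReal_le_ofReal (one_div_le_one_div_of_le
    (rpow_pos_of_mem (h0.trans hrt) h1 _) ?_)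
  exact Real.rpow_le_rpow (by nlinarith) (by nlinarith) (by positivity)

/-- For `n ≥ 1` the exponent `(n + 1) / 2` is at least one, and `1 - r² ≤ 2 (1 - r) ≤ 2 s`. -/
theorem ofReal_le_radialDensity (hn : 1 ≤ n) {r s : ℝ} (h0 : 0 ≤ r) (h1 : r < 1)
    (hr : 1 - s ≤ r) : ENNReal.ofReal (1 / (2 * s)) ≤ radialDensity n r := by
  have hn' : (1 : ℝ) ≤ n := by exact_mod_cast hn
  refine ENNReal.ofReal_le_ofReal (one_div_le_one_div_of_le (rpow_pos_of_mem h0 h1 _) ?_)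
  have h2 : (1 - r ^ 2) ^ (((n : ℝ) + 1) / 2) ≤ (1 - r ^ 2) ^ (1 : ℝ) :=
    Real.rpow_le_rpow_of_exponent_ge (by nlinarith) (by nlinarith) (by linarith)
  rw [Real.rpow_one] at h2
  nlinarith

theorem volume_le_vol {A : Set (E n)} (hA : MeasurableSet A) (hs : A ⊆ space n) :
    volume A ≤ vol n A := by
  rw [vol_apply hA hs, ← setLIntegral_one]
  exact setLIntegral_mono' hA fun x hx => one_le_radialDensity (norm_nonneg x) (mem_space.1 (hs hx))

theorem closedBall_subset_space {r : ℝ} (hr : r < 1) : Metric.closedBall (0 : E n) r ⊆ space n :=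
  Metric.closedBall_subset_ball hr

theorem vol_closedBall_lt_top {r : ℝ} (hr : r < 1) : vol n (Metric.closedBall 0 r) < ⊤ := by
  rw [vol_apply measurableSet_closedBall (closedBall_subset_space hr)]
  calc ∫⁻ x in Metric.closedBall (0 : E n) r, radialDensity n ‖x‖
      ≤ ∫⁻ _ in Metric.closedBall (0 : E n) r, radialDensity n r :=
        setLIntegral_mono' measurableSet_closedBall fun x hx =>
          radialDensity_le (norm_nonneg x) (mem_closedBall_zero_iff.1 hx) hr
    _ = radialDensity n r * volume (Metric.closedBall (0 : E n) r) := setLIntegral_const _ _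
    _ < ⊤ := ENNReal.mul_lt_top ENNReal.ofReal_lt_top measure_closedBall_lt_top

/-- Rotations about the origin preserve the hyperbolic volume. -/
theorem vol_preimage (A : E n ≃ₗᵢ[ℝ] E n) {S : Set (E n)} (hS : MeasurableSet S) :
    vol n (A ⁻¹' S) = vol n S := by
  have hpre : A ⁻¹' S ∩ space n = A ⁻¹' (S ∩ space n) := by
    ext x
    simp [mem_space]
  rw [← vol_inter_space, ← vol_inter_space S, hpre, vol_apply
    (A.continuous.measurable (hS.inter (measurableSet_space n))) (hpre ▸ inter_subset_right),
    vol_apply (hS.inter (measurableSet_space n)) inter_subset_right,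
    ← A.measurePreserving.setLIntegral_comp_preimage (f := fun x => radialDensity n ‖x‖)
      (hS.inter (measurableSet_space n)) ((measurable_radialDensity n).comp measurable_norm)]
  simp

/-- The hyperplanes through the origin are null sets. -/
theorem vol_hyperplane {u : E n} (hu : u ≠ 0) : vol n {x | inner ℝ u x = 0} = 0 := by
  refine vol_absolutelyContinuous n ?_
  have h1 : {x : E n | inner ℝ u x = 0} = (LinearMap.ker (innerSL ℝ u).toLinearMap : Set (E n)) := by
    ext x; simp
  rw [h1]
  refine Measure.addHaar_submodule _ _ fun h => hu ?_
  have h2 : u ∈ LinearMap.ker (innerSL ℝ u).toLinearMap := h ▸ Submodule.mem_top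
  simpa using h2

/-! ### Volumes of cones -/

/-- A set that is invariant under scaling by positive factors. -/
def IsCone (K : Set (E n)) : Prop := ∀ t : ℝ, 0 < t → ∀ x ∈ K, t • x ∈ K

-- Scaling by `t` carries the unit piece of the cone to the piece of radius `t`. The
-- cross-multiplied form avoids division and also covers `t ≤ 0`, where both sides vanish.
open scoped Pointwise in
theorem IsCone.volume_inter_closedBall (hn : 1 ≤ n) {K : Set (E n)} (hK : IsCone K) (t : ℝ) :
    volume (K ∩ Metric.closedBall 0 t) * volume (Metric.closedBall (0 : E n) 1) =
      volume (K ∩ Metric.closedBall 0 1) * volume (Metric.closedBall (0 : E n) t) := by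
  have : Nonempty (Fin n) := ⟨⟨0, hn⟩⟩
  rcases lt_trichotomy t 0 with ht | rfl | ht
  · simp [Metric.closedBall_eq_empty.2 ht]
  · have h0 : volume (K ∩ {(0 : E n)}) = 0 := measure_mono_null inter_subset_right (by simp)
    rw [Metric.closedBall_zero, h0, measure_singleton, zero_mul, mul_zero]
  · have h1 : t • Metric.closedBall (0 : E n) 1 = Metric.closedBall 0 t := by
      rw [smul_unitClosedBall, Real.norm_of_nonneg ht.le]
    have h2 : t • (K ∩ Metric.closedBall (0 : E n) 1) = K ∩ Metric.closedBall 0 t := by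
      rw [smul_set_inter₀ ht.ne', h1]
      congr 1
      ext x
      rw [mem_smul_set_iff_inv_smul_mem₀ ht.ne']
      refine ⟨fun hx => ?_, fun hx => hK _ (inv_pos.2 ht) _ hx⟩
      have := hK t ht _ hx
      rwa [smul_inv_smul₀ ht.ne'] at this
    rw [← h2, ← h1, Measure.addHaar_smul, Measure.addHaar_smul]
    ring

/-- A cone takes up the same proportion of every ball about the origin, hyperbolically and
Euclideanly. -/
theorem IsCone.vol_inter_closedBall (hn : 1 ≤ n) {K : Set (E n)} (hK : IsCone K)
    (hm : MeasurableSet K) {r : ℝ} (hr : r < 1) :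
    vol n (K ∩ Metric.closedBall 0 r) * volume (Metric.closedBall (0 : E n) 1) =
      volume (K ∩ Metric.closedBall 0 1) * vol n (Metric.closedBall 0 r) := by
  set b := volume (Metric.closedBall (0 : E n) 1) with hb
  set k := volume (K ∩ Metric.closedBall (0 : E n) 1) with hk
  have hbt : b ≠ ⊤ := measure_closedBall_lt_top.ne
  have hms : MeasurableSet (K ∩ Metric.closedBall (0 : E n) r) := hm.inter measurableSet_closedBall
  have hfin : IsFiniteMeasure (volume.restrict (K ∩ Metric.closedBall (0 : E n) r)) :=
    ⟨by
      rw [Measure.restrict_apply_univ]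
      exact (measure_mono inter_subset_right).trans_lt measure_closedBall_lt_top⟩
  have hfin' : IsFiniteMeasure (b • (volume.restrict (K ∩ Metric.closedBall (0 : E n) r)).map
      (fun x => ‖x‖)) := Measure.smul_finite _ hbt
  -- The laws of the norm on the cone piece and on the ball are proportional. Hyperbolic volume
  -- integrates a radial density, hence depends only on these laws.
  have key : b • (volume.restrict (K ∩ Metric.closedBall (0 : E n) r)).map (fun x => ‖x‖) =
      k • (volume.restrict (Metric.closedBall (0 : E n) r)).map (fun x => ‖x‖) := by
    refine Measure.ext_of_Iic _ _ fun a => ?_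
    have hpre : (fun x : E n => ‖x‖) ⁻¹' Iic a = Metric.closedBall 0 a := by
      ext x; simp
    have hball : Metric.closedBall (0 : E n) a ∩ Metric.closedBall 0 r
        = Metric.closedBall 0 (min a r) := by
      ext x; simp
    rw [Measure.smul_apply, Measure.smul_apply, Measure.map_apply measurable_norm measurableSet_Iic,
      Measure.map_apply measurable_norm measurableSet_Iic, hpre,
      Measure.restrict_apply measurableSet_closedBall,
      Measure.restrict_apply measurableSet_closedBall, inter_left_comm, hball, smul_eq_mul,
      smul_eq_mul, mul_comm b]
    exact hK.volume_inter_closedBall hn _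
  have h1 := congrArg (fun μ => ∫⁻ s, radialDensity n s ∂μ) key
  simp only [lintegral_smul_measure, smul_eq_mul] at h1
  rw [lintegral_map (measurable_radialDensity n) measurable_norm,
    lintegral_map (measurable_radialDensity n) measurable_norm] at h1
  rw [vol_apply hms (inter_subset_right.trans (closedBall_subset_space hr)),
    vol_apply measurableSet_closedBall (closedBall_subset_space hr), mul_comm, h1]

/-! ### The volume of large balls -/

theorem ofReal_mul_volume_le (hn : 1 ≤ n) {s : ℝ} (h0 : 0 < s) (h1 : s < 1) :
    ENNReal.ofReal s * volume (space n) ≤ volume (space n \ Metric.ball (0 : E n) (1 - s)) := by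
  have hb : volume (Metric.ball (0 : E n) (1 - s)) ≤ ENNReal.ofReal (1 - s) * volume (space n) := by
    rw [Measure.addHaar_ball_of_pos _ _ (by linarith), space]
    gcongr
    rw [finrank_euclideanSpace, Fintype.card_fin]
    calc (1 - s) ^ n ≤ (1 - s) ^ 1 := pow_le_pow_of_le_one (by linarith) (by linarith) hn
      _ = 1 - s := pow_one _
  have hsub : Metric.ball (0 : E n) (1 - s) ⊆ space n := Metric.ball_subset_ball (by linarith)
  have hfin : volume (space n) ≠ ⊤ := measure_ball_lt_top.ne
  rw [measure_sdiff hsub measurableSet_ball.nullMeasurableSet measure_ball_lt_top.ne]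
  refine le_trans ?_ (tsub_le_tsub_left hb _)
  rw [ENNReal.ofReal_sub _ h0.le, ENNReal.ofReal_one, ENNReal.sub_mul (fun _ _ => hfin), one_mul,
    ENNReal.sub_sub_cancel hfin]
  calc ENNReal.ofReal s * volume (space n) ≤ 1 * volume (space n) := by
        gcongr
        rw [ENNReal.ofReal_le_one]
        exact h1.le
    _ = _ := one_mul _

/-- Hyperbolic space has infinite volume. -/
theorem vol_space (hn : 1 ≤ n) : vol n (space n) = ⊤ := by
  by_contra hfin
  set s : ℕ → ℝ := fun k => 1 / ((k : ℝ) + 2) with hs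
  have hs0 : ∀ k, 0 < s k := fun k => by positivity
  have hs1 : ∀ k, s k < 1 := fun k => by
    rw [hs, div_lt_one (by positivity)]
    have : (0 : ℝ) ≤ k := by positivity
    linarith
  -- A shell of width `s` has Euclidean volume at least `s` times that of the ball and density at
  -- least `1 / (2 s)`. The shells decrease to the empty set, so a finite volume would force these
  -- masses to zero.
  have hlow : ∀ k, ENNReal.ofReal (1 / 2) * volume (space n)
      ≤ vol n (space n \ Metric.ball (0 : E n) (1 - s k)) := fun k => by
    have hm : MeasurableSet (space n \ Metric.ball (0 : E n) (1 - s k)) :=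
      (measurableSet_space n).diff measurableSet_ball
    have hsk := (hs0 k).ne'
    rw [vol_apply hm sdiff_subset]
    calc ENNReal.ofReal (1 / 2) * volume (space n)
        = ENNReal.ofReal (1 / (2 * s k)) * (ENNReal.ofReal (s k) * volume (space n)) := by
          rw [← mul_assoc, ← ENNReal.ofReal_mul (by have := hs0 k; positivity)]
          congr 2
          field_simp
      _ ≤ ENNReal.ofReal (1 / (2 * s k)) * volume (space n \ Metric.ball (0 : E n) (1 - s k)) := by
          gcongr
          exact ofReal_mul_volume_le hn (hs0 k) (hs1 k)
      _ = ∫⁻ _ in space n \ Metric.ball (0 : E n) (1 - s k), ENNReal.ofReal (1 / (2 * s k)) :=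
          (setLIntegral_const _ _).symm
      _ ≤ _ := setLIntegral_mono' hm fun x hx => by
          refine ofReal_le_radialDensity hn (norm_nonneg x) (mem_space.1 hx.1) ?_
          simpa using hx.2
  have hanti : Antitone fun k => space n \ Metric.ball (0 : E n) (1 - s k) := fun k l hkl => by
    refine sdiff_subset_sdiff_right (Metric.ball_subset_ball ?_)
    have : s l ≤ s k := one_div_le_one_div_of_le (by positivity) (by gcongr)
    linarith
  have hst : Tendsto (fun k => 1 - s k) atTop (𝓝 1) := by
    have h2 : Tendsto s atTop (𝓝 0) := by
      have := (tendsto_add_atTop_iff_nat 1).2 (tendsto_one_div_add_atTop_nhds_zero_nat (𝕜 := ℝ))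
      refine this.congr fun k => ?_
      rw [hs]
      push_cast
      ring
    simpa using h2.const_sub 1
  have hinter : ⋂ k, space n \ Metric.ball (0 : E n) (1 - s k) = ∅ := by
    refine eq_empty_of_forall_notMem fun x hx => ?_
    rw [mem_iInter] at hx
    have h1 : (1 : ℝ) ≤ ‖x‖ := le_of_tendsto' hst fun k => by simpa using (hx k).2
    exact absurd (mem_space.1 (hx 0).1) h1.not_gt
  have hlim := tendsto_measure_iInter_atTop (μ := vol n)
    (fun k => ((measurableSet_space n).diff
      (measurableSet_ball (x := (0 : E n)) (ε := 1 - s k))).nullMeasurableSet) hanti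
    ⟨0, ne_top_of_le_ne_top hfin (measure_mono sdiff_subset)⟩
  rw [hinter, measure_empty] at hlim
  have h3 := ge_of_tendsto' hlim hlow
  have h4 : 0 < ENNReal.ofReal (1 / 2) * volume (space n) :=
    ENNReal.mul_pos (by simp) (Metric.measure_ball_pos _ _ one_pos).ne'
  exact absurd h3 h4.not_ge

/-- The volume of hyperbolic balls tends to infinity. -/
theorem eventually_lt_vol_closedBall (hn : 1 ≤ n) {M : ENNReal} (hM : M ≠ ⊤) :
    ∀ᶠ ε in 𝓝[>] (0 : ℝ), M < vol n (Metric.closedBall 0 (1 - ε)) := by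
  set r : ℕ → ℝ := fun k => 1 - 1 / ((k : ℝ) + 1) with hr
  have hmono : Monotone fun k => Metric.closedBall (0 : E n) (r k) := fun k l hkl => by
    refine Metric.closedBall_subset_closedBall (sub_le_sub_left ?_ _)
    exact one_div_le_one_div_of_le (by positivity) (by gcongr)
  have hrt : Tendsto r atTop (𝓝 1) := by
    simpa [hr] using (tendsto_one_div_add_atTop_nhds_zero_nat (𝕜 := ℝ)).const_sub 1
  have hU : space n ⊆ ⋃ k, Metric.closedBall (0 : E n) (r k) := fun x hx => by
    obtain ⟨k, hk⟩ := (hrt.eventually (lt_mem_nhds (mem_space.1 hx))).exists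
    exact mem_iUnion.2 ⟨k, mem_closedBall_zero_iff.2 hk.le⟩
  have hlim := tendsto_measure_iUnion_atTop (μ := vol n) hmono
  have htop : vol n (⋃ k, Metric.closedBall (0 : E n) (r k)) = ⊤ :=
    top_le_iff.1 ((vol_space hn).ge.trans (measure_mono hU))
  rw [htop] at hlim
  obtain ⟨k, hk⟩ := (hlim.eventually (lt_mem_nhds hM.lt_top)).exists
  filter_upwards [Ioo_mem_nhdsGT (show (0 : ℝ) < 1 / ((k : ℝ) + 1) by positivity)] with ε hε
  refine lt_of_lt_of_le hk (measure_mono (Metric.closedBall_subset_closedBall ?_))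
  rw [hr]
  linarith [hε.2]

end Volume

end Klein

namespace Klein

/-! ### The truncated simplex -/

section Truncated

variable {n : ℕ} {p : Fin (n + 1) → E n} {R ε : ℝ}

/-- The simplex with vertices `p`, intersected with the closed ball of radius `1 - ε`. -/
def truncatedHull (p : Fin (n + 1) → E n) (ε : ℝ) : Set (E n) :=
  convexHull ℝ (range p) ∩ Metric.closedBall 0 (1 - ε)

theorem isCompact_truncatedHull (p : Fin (n + 1) → E n) (ε : ℝ) :
    IsCompact (truncatedHull p ε) :=
  ((finite_range p).isCompact_convexHull ℝ).inter_right Metric.isClosed_closedBall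

theorem measurableSet_truncatedHull (p : Fin (n + 1) → E n) (ε : ℝ) :
    MeasurableSet (truncatedHull p ε) := (isCompact_truncatedHull p ε).measurableSet

theorem truncatedHull_subset_space (p : Fin (n + 1) → E n) (hε : 0 < ε) :
    truncatedHull p ε ⊆ space n :=
  inter_subset_right.trans (closedBall_subset_space (by linarith))

theorem convex_truncatedHull (p : Fin (n + 1) → E n) (ε : ℝ) : Convex ℝ (truncatedHull p ε) :=
  (convex_convexHull ℝ _).inter (convex_closedBall 0 _)

theorem IsRegular.exists_ball_subset (H : IsRegular p R) (hε : ε < 1) :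
    ∃ ρ, 0 < ρ ∧ Metric.ball 0 ρ ⊆ truncatedHull p ε := by
  refine ⟨min (R / n) (1 - ε), lt_min (div_pos H.pos H.cast_pos) (by linarith), ?_⟩
  refine subset_inter ((Metric.ball_subset_ball (min_le_left _ _)).trans H.ball_subset) ?_
  exact (Metric.ball_subset_ball (min_le_right _ _)).trans Metric.ball_subset_closedBall

theorem IsRegular.vol_truncatedHull_ne_zero (H : IsRegular p R) (hε : ε ∈ Ioo (0 : ℝ) 1) :
    vol n (truncatedHull p ε) ≠ 0 := by
  obtain ⟨ρ, hρ, hsub⟩ := H.exists_ball_subset hε.2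
  have h1 := volume_le_vol measurableSet_ball (hsub.trans (truncatedHull_subset_space p hε.1))
  exact ((Metric.measure_ball_pos volume (0 : E n) hρ).trans_le (h1.trans (measure_mono hsub))).ne'

theorem vol_truncatedHull_ne_top (p : Fin (n + 1) → E n) (hε : 0 < ε) :
    vol n (truncatedHull p ε) ≠ ⊤ :=
  ((measure_mono inter_subset_right).trans_lt (vol_closedBall_lt_top (by linarith))).ne

theorem IsRegular.isProbabilityMeasure_uniform (H : IsRegular p R) (hε : ε ∈ Ioo (0 : ℝ) 1) :
    IsProbabilityMeasure (uniform (truncatedHull p ε)) :=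
  ProbabilityTheory.cond_isProbabilityMeasure_of_finite (H.vol_truncatedHull_ne_zero hε)
    (vol_truncatedHull_ne_top p hε.1)

theorem uniform_apply {S : Set (E n)} (hS : MeasurableSet S) (A : Set (E n)) :
    uniform S A = (vol n S)⁻¹ * vol n (S ∩ A) := ProbabilityTheory.cond_apply hS _ _

theorem IsSymmetry.uniform_preimage {A : E n ≃ₗᵢ[ℝ] E n} (hA : IsSymmetry p A) (ε : ℝ)
    {B : Set (E n)} (hB : MeasurableSet B) :
    uniform (truncatedHull p ε) (A ⁻¹' B) = uniform (truncatedHull p ε) B := by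
  have hS := measurableSet_truncatedHull p ε
  have h1 : A ⁻¹' truncatedHull p ε = truncatedHull p ε := by
    rw [truncatedHull, preimage_inter, hA.preimage_convexHull]
    congr 1
    ext x
    simp
  rw [uniform_apply hS, uniform_apply hS]
  nth_rw 2 [← h1]
  rw [← preimage_inter, vol_preimage A (hS.inter hB)]

theorem measurableSet_euclideanHalfspace (x u : E n) : MeasurableSet (euclideanHalfspace x u) :=
  (measurableSet_space n).inter (measurableSet_lt (f := fun y : E n => inner ℝ (y - x) u)
    (by fun_prop) measurable_const)

theorem preimage_euclideanHalfspace (A : E n ≃ₗᵢ[ℝ] E n) (x u : E n) :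
    A ⁻¹' euclideanHalfspace (A x) u = euclideanHalfspace x (A.symm u) := by
  ext y
  refine and_congr (by simp [mem_space]) ?_
  rw [← map_sub, ← A.inner_map_map (y - x), A.apply_symm_apply]

theorem zero_mem_space : (0 : E n) ∈ space n := by simp [mem_space]

/-- Invariance of the measure lets halfspaces at any symmetric image of `y` be tested in place of
those at `y`. -/
theorem IsSymmetry.uniform_le_centrality (hn : 1 ≤ n) {A : E n ≃ₗᵢ[ℝ] E n} (hA : IsSymmetry p A)
    (ε : ℝ) {y : E n} (hy : y ∈ space n) (u : E n) :
    uniform (truncatedHull p ε) (euclideanHalfspace (A y) u)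
      ≤ centrality (uniform (truncatedHull p ε)) y := by
  rw [← hA.uniform_preimage ε (measurableSet_euclideanHalfspace _ _), preimage_euclideanHalfspace,
    centrality_eq hn _ hy]
  exact le_iSup (fun u => uniform (truncatedHull p ε) (euclideanHalfspace y u)) _

/-! ### The optimal centerpoint -/

/-- The origin is an optimal centerpoint. -/
theorem IsRegular.isOptimalCenterpoint_zero (H : IsRegular p R) (ε : ℝ) :
    IsOptimalCenterpoint (uniform (truncatedHull p ε)) 0 := by
  refine ⟨zero_mem_space, fun y hy => ?_⟩
  rw [centrality_eq H.one_le _ zero_mem_space]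
  refine iSup_le fun u => ?_
  obtain ⟨A, hA, hsum⟩ := H.exists_rotations
  obtain ⟨k, -, hk⟩ : ∃ k ∈ Finset.univ, (0 : ℝ) ≤ inner ℝ (A k y) u := by
    refine Finset.exists_le_of_sum_le Finset.univ_nonempty (f := fun _ => (0 : ℝ)) ?_
    rw [← sum_inner, hsum, inner_zero_left]
    simp
  have hAk : IsSymmetry p (A k) := ⟨Equiv.addRight k, hA k⟩
  refine le_trans (measure_mono ?_) (hAk.uniform_le_centrality H.one_le ε hy u)
  refine fun z hz => ⟨hz.1, ?_⟩
  have := hz.2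
  rw [sub_zero] at this
  rw [inner_sub_left]
  linarith

/-- The images of a nonzero point under the symmetries reach uniformly far in every direction. -/
theorem IsRegular.exists_uniform_inner (H : IsRegular p R) {y : E n} (hy : y ≠ 0) :
    ∃ η, 0 < η ∧ ∀ u : E n, ‖u‖ = 1 → ∃ A, IsSymmetry p A ∧ η ≤ inner ℝ (A y) u := by
  have key : ∃ η, 0 < η ∧ ∀ u ∈ Metric.sphere (0 : E n) 1,
      ∃ A, IsSymmetry p A ∧ η ≤ inner ℝ (A y) u := by
    -- Compactness of the sphere: a symmetry that works for `u` works nearby with half the inner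
    -- product.
    refine (isCompact_sphere (0 : E n) 1).induction_on (p := fun s => ∃ η : ℝ, 0 < η ∧ ∀ u ∈ s,
      ∃ A, IsSymmetry p A ∧ η ≤ inner ℝ (A y) u) ⟨1, one_pos, by simp⟩ ?_ ?_ ?_
    · rintro s t hst ⟨η, hη, h⟩
      exact ⟨η, hη, fun u hu => h u (hst hu)⟩
    · rintro s t ⟨η, hη, h⟩ ⟨η', hη', h'⟩
      refine ⟨min η η', lt_min hη hη', fun u hu => ?_⟩
      rcases hu with hu | hu
      · obtain ⟨A, hA, hle⟩ := h u hu
        exact ⟨A, hA, (min_le_left _ _).trans hle⟩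
      · obtain ⟨A, hA, hle⟩ := h' u hu
        exact ⟨A, hA, (min_le_right _ _).trans hle⟩
    · intro u hu
      have hu0 : u ≠ 0 := by
        rintro rfl
        simp at hu
      obtain ⟨A, hA, hpos⟩ := H.exists_inner_pos hy hu0
      refine ⟨{v | inner ℝ (A y) u / 2 < inner ℝ (A y) v}, mem_nhdsWithin_of_mem_nhds ?_,
        inner ℝ (A y) u / 2, by linarith, fun v hv => ⟨A, hA, le_of_lt hv⟩⟩
      exact (isOpen_lt continuous_const (continuous_const.inner continuous_id)).mem_nhds
        (by simp only [mem_ofPred_eq, id]; linarith)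
  obtain ⟨η, hη, h⟩ := key
  exact ⟨η, hη, fun u hu => h u (by simpa using hu)⟩

/-- Away from the origin the centrality function exceeds its minimum. -/
theorem IsRegular.centrality_zero_lt (H : IsRegular p R) (hε : ε ∈ Ioo (0 : ℝ) 1) {y : E n}
    (hy : y ∈ space n) (hy0 : y ≠ 0) :
    centrality (uniform (truncatedHull p ε)) 0 < centrality (uniform (truncatedHull p ε)) y := by
  have := H.isProbabilityMeasure_uniform hε
  have : Nonempty (Fin n) := ⟨⟨0, H.one_le⟩⟩
  have hS := measurableSet_truncatedHull p ε
  set μ := uniform (truncatedHull p ε) with hμ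
  obtain ⟨η, hη, hunif⟩ := H.exists_uniform_inner hy0
  obtain ⟨ρ, hρ, hball⟩ := H.exists_ball_subset hε.2
  -- The ball of radius `r` about `r • u` then lies in the slab `0 < ⟨z, u⟩ < η` and inside the
  -- truncated simplex.
  set r := min η ρ / 2 with hr
  have hr0 : 0 < r := half_pos (lt_min hη hρ)
  have hrη : 2 * r ≤ η := by rw [hr]; linarith [min_le_left η ρ]
  have hrρ : 2 * r ≤ ρ := by rw [hr]; linarith [min_le_right η ρ]
  set κ := (vol n (truncatedHull p ε))⁻¹ * volume (Metric.ball (0 : E n) r) with hκ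
  have hκ0 : 0 < κ := ENNReal.mul_pos (ENNReal.inv_ne_zero.2 (vol_truncatedHull_ne_top p hε.1))
    (Metric.measure_ball_pos _ _ hr0).ne'
  -- The gain `κ` does not depend on `u`, so it survives the supremum.
  have hslab : ∀ u : E n, ‖u‖ = 1 → μ (euclideanHalfspace 0 u) + κ ≤ centrality μ y := by
    intro u hu
    obtain ⟨A, hA, hle⟩ := hunif u hu
    have hsub : Metric.ball (r • u) r ⊆ truncatedHull p ε := fun z hz => by
      refine hball (mem_ball_zero_iff.2 ?_)
      have h1 := norm_add_le (z - r • u) (r • u)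
      rw [sub_add_cancel, norm_smul, hu, mul_one, Real.norm_of_nonneg hr0.le] at h1
      have h2 : ‖z - r • u‖ < r := by rwa [← dist_eq_norm]
      linarith
    have hinner : ∀ z ∈ Metric.ball (r • u) r, 0 < inner ℝ z u ∧ inner ℝ z u < 2 * r := by
      intro z hz
      have h1 := abs_real_inner_le_norm (z - r • u) u
      rw [hu, mul_one, inner_sub_left, real_inner_smul_left, real_inner_self_eq_norm_sq, hu,
        one_pow, mul_one] at h1
      have h2 : ‖z - r • u‖ < r := by rwa [← dist_eq_norm]
      have h3 := abs_lt.1 (h1.trans_lt h2)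
      constructor <;> linarith [h3.1, h3.2]
    have hκle : κ ≤ μ (Metric.ball (r • u) r) := by
      rw [hκ, hμ, uniform_apply hS, inter_eq_right.2 hsub,
        ← Measure.addHaar_ball_center volume (r • u) r]
      refine mul_le_mul_right ?_ _
      exact volume_le_vol measurableSet_ball (hsub.trans (truncatedHull_subset_space p hε.1))
    have hdisj : Disjoint (euclideanHalfspace 0 u) (Metric.ball (r • u) r) :=
      disjoint_left.2 fun z hz hz' => by
        have h1 := hz.2
        rw [sub_zero] at h1
        exact lt_asymm h1 (hinner z hz').1
    refine le_trans ?_ (hA.uniform_le_centrality H.one_le ε hy u)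
    calc μ (euclideanHalfspace 0 u) + κ
        ≤ μ (euclideanHalfspace 0 u) + μ (Metric.ball (r • u) r) := by gcongr
      _ = μ (euclideanHalfspace 0 u ∪ Metric.ball (r • u) r) :=
          (measure_union hdisj measurableSet_ball).symm
      _ ≤ μ (euclideanHalfspace (A y) u) := by
          refine measure_mono (union_subset (fun z hz => ⟨hz.1, ?_⟩)
            fun z hz => ⟨truncatedHull_subset_space p hε.1 (hsub hz), ?_⟩)
          · have h1 := hz.2
            rw [sub_zero] at h1
            rw [inner_sub_left]
            linarith
          · rw [inner_sub_left]
            linarith [(hinner z hz).2]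
  have hall : ∀ u : E n, μ (euclideanHalfspace 0 u) + κ ≤ centrality μ y := by
    intro u
    rcases eq_or_ne u 0 with rfl | hu
    · obtain ⟨e, he⟩ := exists_norm_eq (E n) zero_le_one
      refine le_trans ?_ (hslab e he)
      gcongr
      intro z hz
      simpa using hz.2
    · have h1 : euclideanHalfspace 0 u = euclideanHalfspace 0 (‖u‖⁻¹ • u) := by
        ext z
        refine and_congr_right fun _ => ?_
        have := inv_pos.2 (norm_pos_iff.2 hu)
        rw [real_inner_smul_right, ← neg_pos, ← neg_pos (a := _ * _), ← mul_neg,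
          mul_pos_iff_of_pos_left this]
      rw [h1]
      exact hslab _ (norm_smul_inv_norm hu)
  have hle : centrality μ 0 + κ ≤ centrality μ y := by
    rw [centrality_eq H.one_le _ zero_mem_space, ENNReal.iSup_add]
    exact iSup_le hall
  have hfin : centrality μ 0 ≠ ⊤ :=
    ne_top_of_le_ne_top (measure_ne_top μ univ) (iSup_le fun v => measure_mono (subset_univ _))
  exact (ENNReal.lt_add_right hfin hκ0.ne').trans_le hle

/-! ### The depth of the origin -/

/-- The origin is always a `1 / (n + 1)`-centerpoint. -/
theorem IsRegular.isCenterpoint_zero (H : IsRegular p R) (hε : ε ∈ Ioo (0 : ℝ) 1) :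
    IsCenterpoint (uniform (truncatedHull p ε)) (1 / ((n : ℝ) + 1)) 0 := by
  have := H.isProbabilityMeasure_uniform hε
  refine ⟨zero_mem_space, fun u => ?_⟩
  rw [halfspace_zero H.one_le]
  set μ := uniform (truncatedHull p ε)
  obtain ⟨A, hA, hsum⟩ := H.exists_rotations
  have hm := measurableSet_euclideanHalfspace (0 : E n) u
  -- Otherwise all rotations of `x` have negative inner product with `u`, although they sum to zero.
  have hcover : ⋃ k, A k ⁻¹' (euclideanHalfspace 0 u)ᶜ = univ := by
    refine eq_univ_of_forall fun x => ?_
    by_contra hx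
    have hx' : ∀ k, A k x ∈ euclideanHalfspace 0 u := by simpa using hx
    have h1 : ∑ k, inner ℝ (A k x) u = (0 : ℝ) := by rw [← sum_inner, hsum, inner_zero_left]
    refine absurd h1 (Finset.sum_neg (fun k _ => ?_) Finset.univ_nonempty).ne
    simpa using (hx' k).2
  have h1 : ∀ k, μ.real (A k ⁻¹' (euclideanHalfspace 0 u)ᶜ) = 1 - μ.real (euclideanHalfspace 0 u) :=
    fun k => by
      rw [measureReal_def, IsSymmetry.uniform_preimage ⟨Equiv.addRight k, hA k⟩ ε hm.compl,
        ← measureReal_def, probReal_compl_eq_one_sub hm]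
  have h2 := measureReal_iUnion_fintype_le (μ := μ) fun k => A k ⁻¹' (euclideanHalfspace 0 u)ᶜ
  rw [hcover, probReal_univ] at h2
  simp only [h1, Finset.sum_const, Finset.card_univ, Fintype.card_fin, nsmul_eq_mul] at h2
  push_cast at h2
  have h3 : 1 / ((n : ℝ) + 1) ≤ 1 - μ.real (euclideanHalfspace 0 u) := by
    rw [div_le_iff₀' (by positivity)]
    exact h2
  linarith

/-- The open halfspace towards the vertex `p i`. -/
def towards (p : Fin (n + 1) → E n) (i : Fin (n + 1)) : Set (E n) := {x | 0 < inner ℝ (p i) x}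

theorem measurableSet_towards (p : Fin (n + 1) → E n) (i : Fin (n + 1)) :
    MeasurableSet (towards p i) := measurableSet_lt measurable_const (by fun_prop)

/-- Up to null sets, the open halfspace towards `p i` is the complement of the halfspace at `0` in
direction `p i`. -/
theorem IsRegular.le_uniform_towards (H : IsRegular p R) (hε : ε ∈ Ioo (0 : ℝ) 1) {b : ℝ}
    (hb : IsCenterpoint (uniform (truncatedHull p ε)) b 0) (i : Fin (n + 1)) :
    b ≤ (uniform (truncatedHull p ε)).real (towards p i) := by
  have := H.isProbabilityMeasure_uniform hε
  set μ := uniform (truncatedHull p ε) with hμ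
  have hS := measurableSet_truncatedHull p ε
  have h1 := hb.2 (p i)
  rw [halfspace_zero H.one_le] at h1
  have hpi : p i ≠ 0 := fun h => by
    have := H.norm_eq i
    rw [h, norm_zero] at this
    exact H.pos.ne this
  have hnull : μ ({x | inner ℝ (p i) x = 0} ∪ (truncatedHull p ε)ᶜ) = 0 := by
    refine measure_union_null ?_ ?_
    · rw [hμ, uniform_apply hS, measure_mono_null inter_subset_right (vol_hyperplane hpi), mul_zero]
    · rw [hμ, uniform_apply hS, inter_compl_self, measure_empty, mul_zero]
  have hcover : (univ : Set (E n)) ⊆ (euclideanHalfspace 0 (p i) ∪ towards p i)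
      ∪ ({x | inner ℝ (p i) x = 0} ∪ (truncatedHull p ε)ᶜ) := by
    intro x _
    by_cases hx : x ∈ truncatedHull p ε
    · rcases lt_trichotomy (inner ℝ (p i) x) (0 : ℝ) with h | h | h
      · refine Or.inl (Or.inl ⟨truncatedHull_subset_space p hε.1 hx, ?_⟩)
        rwa [sub_zero, real_inner_comm]
      · exact Or.inr (Or.inl h)
      · exact Or.inl (Or.inr h)
    · exact Or.inr (Or.inr hx)
  have h2 := (measureReal_mono (μ := μ) hcover).trans (measureReal_union_le _ _)
  rw [measureReal_def μ ({x | inner ℝ (p i) x = 0} ∪ _), hnull, ENNReal.toReal_zero, add_zero,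
    probReal_univ] at h2
  have h3 := measureReal_union_le (μ := μ) (euclideanHalfspace 0 (p i)) (towards p i)
  linarith

/-- A form of the Bonferroni inequality. -/
theorem sum_measureReal_le {Ω ι : Type*} [MeasurableSpace Ω] [Fintype ι] [DecidableEq ι]
    (μ : Measure Ω) [IsProbabilityMeasure μ] {P : ι → Set Ω} (hP : ∀ i, MeasurableSet (P i)) :
    ∑ i, μ.real (P i) ≤ 1 + ∑ i, ∑ j ∈ Finset.univ.erase i, μ.real (P i ∩ P j) := by
  -- The points lying in `P i` and in no other `P j`; these sets are disjoint, so their masses add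
  -- up to at most one.
  set Q : ι → Set Ω := fun i => P i \ ⋃ j ∈ Finset.univ.erase i, P j with hQ
  have hQm : ∀ i, MeasurableSet (Q i) := fun i =>
    (hP i).diff (Finset.measurableSet_biUnion _ fun j _ => hP j)
  have hdisj : Pairwise (Function.onFun Disjoint Q) := fun i j hij =>
    disjoint_left.2 fun x hx hx' => hx.2 (mem_biUnion (by simp [hij.symm]) hx'.1)
  have h1 : ∑ i, μ.real (Q i) ≤ 1 := by
    rw [← measureReal_iUnion_fintype hdisj hQm]
    exact measureReal_le_one
  have h2 : ∀ i, μ.real (P i) ≤ μ.real (Q i) + ∑ j ∈ Finset.univ.erase i, μ.real (P i ∩ P j) := by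
    intro i
    have hsub : P i ⊆ Q i ∪ ⋃ j ∈ Finset.univ.erase i, (P i ∩ P j) := fun x hx => by
      by_cases h : x ∈ ⋃ j ∈ Finset.univ.erase i, P j
      · refine Or.inr ?_
        obtain ⟨j, hj, hxj⟩ := mem_iUnion₂.1 h
        exact mem_biUnion hj ⟨hx, hxj⟩
      · exact Or.inl ⟨hx, h⟩
    refine (measureReal_mono hsub).trans ((measureReal_union_le _ _).trans ?_)
    gcongr
    exact measureReal_biUnion_finset_le _ _
  calc ∑ i, μ.real (P i)
      ≤ ∑ i, (μ.real (Q i) + ∑ j ∈ Finset.univ.erase i, μ.real (P i ∩ P j)) :=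
        Finset.sum_le_sum fun i _ => h2 i
    _ ≤ _ := by rw [Finset.sum_add_distrib]; gcongr

/-! ### Concentration of the volume near the ideal boundary -/

/-- The truncated simplices contain a fixed proportion of the balls. -/
theorem IsRegular.exists_mul_vol_closedBall_le (H : IsRegular p R) (hR : 1 < R) :
    ∃ k : ENNReal, k ≠ 0 ∧ ∀ ε, 0 < ε → k * vol n (Metric.closedBall 0 (1 - ε)) ≤
      vol n (truncatedHull p ε) * volume (Metric.closedBall (0 : E n) 1) := by
  have hn := H.cast_pos
  have hq : 0 < R ^ 2 / n := div_pos (pow_pos H.pos 2) hn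
  -- For `‖x‖ ≤ 1` these inequalities imply the facet inequalities. Since `R > 1`, the open cone
  -- contains `p 0`, hence has positive measure.
  set K : Set (E n) := {x | ∀ i, -(R ^ 2 / n) * ‖x‖ < inner ℝ (p i) x} with hK
  have hopen : IsOpen K := by
    rw [hK, ofPred_forall]
    exact isOpen_iInter_of_finite fun i => isOpen_lt (by fun_prop) (by fun_prop)
  have hcone : IsCone K := fun t ht x hx i => by
    rw [norm_smul, Real.norm_of_nonneg ht.le, real_inner_smul_right, mul_left_comm]
    exact mul_lt_mul_of_pos_left (hx i) ht
  have hp0 : p 0 ∈ K := fun i => by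
    rw [H.norm_eq]
    rcases eq_or_ne i 0 with rfl | hi
    · rw [real_inner_self_eq_norm_sq, H.norm_eq]
      nlinarith [mul_pos hq H.pos, pow_pos H.pos 2]
    · rw [H.inner_eq hi]
      nlinarith
  have hpos : volume (K ∩ Metric.closedBall (0 : E n) 1) ≠ 0 := by
    have h1 : (K ∩ Metric.ball (0 : E n) 1).Nonempty := by
      refine ⟨(2 * R)⁻¹ • p 0, hcone _ (by have := H.pos; positivity) _ hp0, ?_⟩
      have := H.pos
      rw [mem_ball_zero_iff, norm_smul, H.norm_eq, Real.norm_of_nonneg (by positivity), mul_inv,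
        mul_assoc, inv_mul_cancel₀ this.ne']
      norm_num
    exact (((hopen.inter Metric.isOpen_ball).measure_pos volume h1).trans_le
      (measure_mono (inter_subset_inter_right _ Metric.ball_subset_closedBall))).ne'
  refine ⟨_, hpos, fun ε hε => ?_⟩
  rw [← hcone.vol_inter_closedBall H.one_le hopen.measurableSet (by linarith)]
  gcongr
  refine fun x hx => ⟨H.mem_convexHull_iff.2 fun i => ?_, hx.2⟩
  have h1 : ‖x‖ ≤ 1 - ε := by simpa using hx.2
  have h2 := hx.1 i
  nlinarith

/-- The part of the simplex towards two vertices is negligible near the ideal boundary. -/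
theorem IsRegular.exists_inter_towards_le (H : IsRegular p R)
    (hR' : ((n : ℝ) - 1) * R ^ 2 ≤ n + 1) {i j : Fin (n + 1)} (hij : i ≠ j) {κ : ENNReal}
    (hκ : κ ≠ 0) :
    ∃ M : ENNReal, M ≠ ⊤ ∧ ∀ ε, 0 < ε →
      vol n (truncatedHull p ε ∩ (towards p i ∩ towards p j)) *
        volume (Metric.closedBall (0 : E n) 1) ≤ M + κ * vol n (Metric.closedBall 0 (1 - ε)) := by
  set T := convexHull ℝ (range p) with hT
  have hTc : IsClosed T := (finite_range p).isClosed_convexHull ℝ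
  have h0T : (0 : E n) ∈ T := H.ball_subset (Metric.mem_ball_self (div_pos H.pos H.cast_pos))
  have hshrink : ∀ x ∈ T, ∀ t : ℝ, 0 ≤ t → t ≤ 1 → t • x ∈ T := fun x hx t ht ht1 =>
    (convex_convexHull ℝ _).smul_mem_of_zero_mem h0T hx ⟨ht, ht1⟩
  set r : ℕ → ℝ := fun k => 1 - 1 / ((k : ℝ) + 1) with hr
  have hr0 : ∀ k, 0 ≤ r k := fun k => by
    rw [hr, sub_nonneg, div_le_one (by positivity)]
    have : (0 : ℝ) ≤ k := by positivity
    linarith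
  have hr1 : ∀ k, r k < 1 := fun k => by
    have : 0 < 1 / ((k : ℝ) + 1) := by positivity
    rw [hr]; linarith
  have hrmono : Monotone r := fun k l hkl =>
    sub_le_sub_left (one_div_le_one_div_of_le (by positivity) (by gcongr)) _
  have hrt : Tendsto r atTop (𝓝 1) := by
    simpa [hr] using (tendsto_one_div_add_atTop_nhds_zero_nat (𝕜 := ℝ)).const_sub 1
  -- Directions whose point at radius `r k` lies in the simplex. As `T` is star-shaped about `0`,
  -- points of the overlap beyond radius `r k` belong to this cone.
  set K : ℕ → Set (E n) := fun k => {x | (r k * ‖x‖⁻¹) • x ∈ T} ∩ (towards p i ∩ towards p j)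
    with hK
  have hKm : ∀ k, MeasurableSet (K k) := fun k => by
    refine MeasurableSet.inter ?_ ((measurableSet_towards p i).inter (measurableSet_towards p j))
    exact (show Measurable fun x : E n => (r k * ‖x‖⁻¹) • x by fun_prop) hTc.measurableSet
  have hKcone : ∀ k, IsCone (K k) := fun k t ht x hx => by
    refine ⟨?_, ?_, ?_⟩
    · rw [mem_ofPred_eq, norm_smul, Real.norm_of_nonneg ht.le, smul_smul]
      have : r k * (t * ‖x‖)⁻¹ * t = r k * ‖x‖⁻¹ := by
        rw [mul_inv]; field_simp
      rw [this]
      exact hx.1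
    · exact (mul_pos ht hx.2.1).trans_eq (real_inner_smul_right (p i) x t).symm
    · exact (mul_pos ht hx.2.2).trans_eq (real_inner_smul_right (p j) x t).symm
  have hKanti : Antitone fun k => K k ∩ Metric.closedBall 0 1 := fun k l hkl x hx => by
    refine ⟨⟨?_, hx.1.2⟩, hx.2⟩
    rcases (hr0 k).eq_or_lt with h0 | h0
    · rw [mem_ofPred_eq, ← h0, zero_mul, zero_smul]
      exact h0T
    · have hl : 0 < r l := h0.trans_le (hrmono hkl)
      have h1 := hshrink _ hx.1.1 (r k / r l) (by positivity)
        ((div_le_one hl).2 (hrmono hkl))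
      rw [smul_smul] at h1
      have h2 : r k / r l * (r l * ‖x‖⁻¹) = r k * ‖x‖⁻¹ := by
        rw [← mul_assoc, div_mul_cancel₀ _ hl.ne']
      rwa [h2] at h1
  -- Since `T` is closed, a common point would have its unit direction in `T`, against
  -- `norm_lt_one`.
  have hKempty : ⋂ k, K k ∩ Metric.closedBall 0 1 = ∅ := by
    refine eq_empty_of_forall_notMem fun x hx => ?_
    rw [mem_iInter] at hx
    have hx0 : x ≠ 0 := by
      rintro rfl
      have := (hx 0).1.2.1
      simp [towards] at this
    have hlim : Tendsto (fun k => (r k * ‖x‖⁻¹) • x) atTop (𝓝 ((1 * ‖x‖⁻¹) • x)) :=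
      (hrt.mul_const _).smul_const _
    have hmem := hTc.mem_of_tendsto hlim (Eventually.of_forall fun k => (hx k).1.1)
    rw [one_mul] at hmem
    have hinv := inv_pos.2 (norm_pos_iff.2 hx0)
    have h1 := H.norm_lt_one hR' hmem hij
      ((mul_pos hinv (hx 0).1.2.1).trans_eq (real_inner_smul_right (p i) x _).symm)
      ((mul_pos hinv (hx 0).1.2.2).trans_eq (real_inner_smul_right (p j) x _).symm)
    exact h1.ne (norm_smul_inv_norm hx0)
  have hlim := tendsto_measure_iInter_atTop (μ := (volume : Measure (E n)))
    (fun k => ((hKm k).inter measurableSet_closedBall).nullMeasurableSet) hKanti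
    ⟨0, ((measure_mono inter_subset_right).trans_lt measure_closedBall_lt_top).ne⟩
  rw [hKempty, measure_empty] at hlim
  obtain ⟨k, hk⟩ := (hlim.eventually (ge_mem_nhds (pos_iff_ne_zero.2 hκ))).exists
  -- `M` accounts for the inner ball, independently of `ε`; the cone part has Euclidean measure at
  -- most `κ`.
  refine ⟨vol n (Metric.closedBall 0 (r k)) * volume (Metric.closedBall (0 : E n) 1),
    ENNReal.mul_ne_top (vol_closedBall_lt_top (hr1 k)).ne measure_closedBall_lt_top.ne,
    fun ε hε => ?_⟩
  have hsub : truncatedHull p ε ∩ (towards p i ∩ towards p j)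
      ⊆ Metric.closedBall 0 (r k) ∪ (K k ∩ Metric.closedBall 0 (1 - ε)) := fun x hx => by
    by_cases hxr : ‖x‖ ≤ r k
    · exact Or.inl (mem_closedBall_zero_iff.2 hxr)
    · push Not at hxr
      refine Or.inr ⟨⟨?_, hx.2⟩, hx.1.2⟩
      have hx0 : 0 < ‖x‖ := (hr0 k).trans_lt hxr
      refine hshrink x hx.1.1 _ (mul_nonneg (hr0 k) (inv_pos.2 hx0).le) ?_
      rw [← div_eq_mul_inv, div_le_one hx0]
      exact hxr.le
  calc vol n (truncatedHull p ε ∩ (towards p i ∩ towards p j)) *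
        volume (Metric.closedBall (0 : E n) 1)
      ≤ (vol n (Metric.closedBall 0 (r k)) + vol n (K k ∩ Metric.closedBall 0 (1 - ε))) *
        volume (Metric.closedBall (0 : E n) 1) := by
        gcongr
        exact (measure_mono hsub).trans (measure_union_le _ _)
    _ = vol n (Metric.closedBall 0 (r k)) * volume (Metric.closedBall (0 : E n) 1) +
        volume (K k ∩ Metric.closedBall 0 1) * vol n (Metric.closedBall 0 (1 - ε)) := by
        rw [add_mul, (hKcone k).vol_inter_closedBall H.one_le (hKm k) (by linarith)]
    _ ≤ _ := by
        gcongr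
        exact hk

theorem IsRegular.tendsto_uniform_inter_towards (H : IsRegular p R) (hR : 1 < R)
    (hR' : ((n : ℝ) - 1) * R ^ 2 ≤ n + 1) {i j : Fin (n + 1)} (hij : i ≠ j) :
    Tendsto (fun ε => (uniform (truncatedHull p ε)).real (towards p i ∩ towards p j))
      (𝓝[>] 0) (𝓝 0) := by
  set b := volume (Metric.closedBall (0 : E n) 1) with hb
  have hb0 : b ≠ 0 := (Metric.measure_closedBall_pos _ _ one_pos).ne'
  have hbt : b ≠ ⊤ := measure_closedBall_lt_top.ne
  obtain ⟨k, hk0, hk⟩ := H.exists_mul_vol_closedBall_le hR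
  have key : Tendsto (fun ε => uniform (truncatedHull p ε) (towards p i ∩ towards p j))
      (𝓝[>] 0) (𝓝 0) := by
    rw [ENNReal.tendsto_nhds_zero]
    intro η hη
    wlog hηt : η ≠ ⊤ generalizing η
    · push Not at hηt
      simp [hηt]
    have hη2 : η / 2 ≠ 0 := (ENNReal.half_pos hη.ne').ne'
    -- One half of `η` pays for the thin cone, the other for `M`, which is eventually dominated by
    -- the volume of the ball.
    have hκ : η / 2 * k ≠ 0 := mul_ne_zero hη2 hk0
    obtain ⟨M, hM, hle⟩ := H.exists_inter_towards_le hR' hij hκ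
    have hM' : M / (η / 2 * k) ≠ ⊤ := ENNReal.div_ne_top hM hκ
    filter_upwards [eventually_lt_vol_closedBall H.one_le hM',
      Ioo_mem_nhdsGT (one_pos (α := ℝ))] with ε h1 hε
    have hVt : vol n (Metric.closedBall 0 (1 - ε)) ≠ ⊤ :=
      (vol_closedBall_lt_top (by linarith [hε.1])).ne
    set V := vol n (Metric.closedBall (0 : E n) (1 - ε))
    set s := vol n (truncatedHull p ε) with hs
    have h2 : M ≤ η / 2 * k * V := by
      rw [mul_comm]
      exact (ENNReal.div_le_iff_le_mul (Or.inl hκ) (Or.inr (bot_lt_of_lt h1).ne')).1 h1.le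
    have h3 : vol n (truncatedHull p ε ∩ (towards p i ∩ towards p j)) * b ≤ η * s * b :=
      calc _ ≤ M + η / 2 * k * V := hle ε hε.1
        _ ≤ η / 2 * k * V + η / 2 * k * V := by gcongr
        _ = η * (k * V) := by rw [mul_assoc, ← add_mul, ENNReal.add_halves]
        _ ≤ η * (s * b) := by exact mul_le_mul_right (hk ε hε.1) _
        _ = η * s * b := (mul_assoc _ _ _).symm
    have h4 := (ENNReal.mul_le_mul_iff_left hb0 hbt).1 h3
    rw [uniform_apply (measurableSet_truncatedHull p ε), mul_comm, ← div_eq_mul_inv]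
    exact ENNReal.div_le_of_le_mul h4
  have := (ENNReal.tendsto_toReal ENNReal.zero_ne_top).comp key
  rwa [ENNReal.toReal_zero] at this

/-- The largest `β` for which the origin is a `β`-centerpoint tends to `1 / (n + 1)`. -/
theorem IsRegular.tendsto_isGreatest (H : IsRegular p R) (hR : 1 < R)
    (hR' : ((n : ℝ) - 1) * R ^ 2 ≤ n + 1) {β : ℝ → ℝ} (hβ : ∀ ε ∈ Ioo (0 : ℝ) 1,
      IsGreatest {b | IsCenterpoint (uniform (truncatedHull p ε)) b 0} (β ε)) :
    Tendsto β (𝓝[>] 0) (𝓝 (1 / ((n : ℝ) + 1))) := by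
  have hmem : Ioo (0 : ℝ) 1 ∈ 𝓝[>] (0 : ℝ) := Ioo_mem_nhdsGT one_pos
  have hlim : Tendsto (fun ε => (1 + ∑ i, ∑ j ∈ Finset.univ.erase i,
      (uniform (truncatedHull p ε)).real (towards p i ∩ towards p j)) / ((n : ℝ) + 1)) (𝓝[>] 0)
      (𝓝 ((1 + ∑ i : Fin (n + 1), ∑ j ∈ Finset.univ.erase i, (0 : ℝ)) / ((n : ℝ) + 1))) := by
    refine (tendsto_const_nhds.add (tendsto_finsetSum _ fun i _ => tendsto_finsetSum _
      fun j hj => ?_)).div_const _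
    exact H.tendsto_uniform_inter_towards hR hR' (Finset.ne_of_mem_erase hj).symm
  simp only [Finset.sum_const_zero, add_zero] at hlim
  refine tendsto_of_tendsto_of_tendsto_of_le_of_le' tendsto_const_nhds hlim ?_ ?_
  · filter_upwards [hmem] with ε hε
    exact (hβ ε hε).2 (H.isCenterpoint_zero hε)
  · filter_upwards [hmem] with ε hε
    have := H.isProbabilityMeasure_uniform hε
    have h1 : ∑ _i : Fin (n + 1), β ε
        ≤ ∑ i, (uniform (truncatedHull p ε)).real (towards p i) :=
      Finset.sum_le_sum fun i _ => H.le_uniform_towards hε (hβ ε hε).1 i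
    have h2 := h1.trans (sum_measureReal_le _ fun i => measurableSet_towards p i)
    rw [Finset.sum_const, Finset.card_univ, Fintype.card_fin, nsmul_eq_mul] at h2
    push_cast at h2
    rwa [le_div_iff₀' (by positivity)]

end Truncated

end Klein

theorem mainTheorem4 (n : ℕ) (hn : 1 ≤ n) (δ : ℝ) (hδ : 0 < δ)
    (hδ' : ((n : ℝ) - 1) * (1 + δ) ^ 2 ≤ (n : ℝ) + 1)
    (s : Affine.Simplex ℝ (Klein.E n) n) (hreg : s.Regular)
    (hins : ∀ i, ‖s.points i‖ = 1 + δ) :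
    (∀ ε ∈ Ioo (0 : ℝ) 1,
      Klein.GeodesicallyConvex (Klein.truncated s ε) ∧ IsCompact (Klein.truncated s ε) ∧
        IsProbabilityMeasure (Klein.uniform (Klein.truncated s ε))) ∧
    ∃ (c : ℝ → Klein.E n) (β : ℝ → ℝ),
      (∀ ε ∈ Ioo (0 : ℝ) 1,
        Klein.IsOptimalCenterpoint (Klein.uniform (Klein.truncated s ε)) (c ε) ∧
        (∀ y, Klein.IsOptimalCenterpoint (Klein.uniform (Klein.truncated s ε)) y → y = c ε) ∧
        IsGreatest {b | Klein.IsCenterpoint (Klein.uniform (Klein.truncated s ε)) b (c ε)}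
          (β ε)) ∧
      Tendsto β (𝓝[>] 0) (𝓝 (1 / ((n : ℝ) + 1))) := by
  have H := Klein.isRegular_points hn (by linarith) s hreg hins
  have hβ : ∀ ε ∈ Ioo (0 : ℝ) 1,
      IsGreatest {b | Klein.IsCenterpoint (Klein.uniform (Klein.truncated s ε)) b 0}
        (1 - (Klein.centrality (Klein.uniform (Klein.truncated s ε)) 0).toReal) := fun ε hε => by
    have := H.isProbabilityMeasure_uniform hε
    exact Klein.isGreatest_isCenterpoint (Klein.uniform (Klein.truncatedHull s.points ε))
      Klein.zero_mem_space
  -- The origin is the optimal centerpoint for every `ε`, so `c` is constant.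
  refine ⟨fun ε hε => ⟨?_, Klein.isCompact_truncatedHull _ ε, H.isProbabilityMeasure_uniform hε⟩,
    fun _ => 0, _, fun ε hε => ⟨H.isOptimalCenterpoint_zero ε, fun y hy => ?_, hβ ε hε⟩,
    H.tendsto_isGreatest (by linarith) hδ' hβ⟩
  · exact Klein.geodesicallyConvex_of_convex hn (Klein.truncatedHull_subset_space _ hε.1)
      (Klein.convex_truncatedHull _ ε)
  · by_contra hy0
    exact (H.centrality_zero_lt hε hy.1 hy0).not_ge (hy.2 0 Klein.zero_mem_space)
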